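/- **Setting.** Let $G$ be a finite directed graph with vertex set $\mathcal V$, each of whose edges carries a delay $0$ or $1$, without directed cycles of total delay $0$. Let $D^{ij}\in\{0,1,2,\dots,\infty\}$ be the smallest total delay of a directed path from $j$ to $i$ ($D^{ii}=0$; $D^{ij}=\infty$ if there is no path). Fix a horizon $T$. For $t=0,\dots,T-1$ consider the stacked system $$x_{t+1}=A_tx_t+B_tu_t+w_t,$$ where $x_t,u_t,w_t$ are partitioned into real vector blocks $x_t^i,u_t^i,w_t^i$, $i\in\mathcal V$ (block sizes may depend on $t$), and $A_t^{ij}=0$, $B_t^{ij}=0$ whenever $D^{ij}>1$. The vectors $x_0^i,w_0^i,\dots,w_{T-1}^i$ ($i\in\mathcal V$) are mutually independent, $x_0^i\sim\mathcal N(0,\Sigma_0^i)$, $w_t^i\sim\mathcal N(0,W_t^i)$ (possibly singular covariances). An admissible policy is a family of measurable functions $\gamma_t^i$ with $u_t^i=\gamma_t^i(\mathcal I_t^i)$, $\mathcal I_t^i=\{x_k^j : j\in\mathcal V,\ 0\le k\le t-D^{ij}\}$. The cost to be minimized over admissible policies is $$\mathbb E\Bigl(\sum_{t=0}^{T-1}\begin{bmatrix}x_t\\u_t\end{bmatrix}^{\mathsf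 T}\begin{bmatrix}Q_t&S_t\\S_t^{\mathsf T}&R_t\end{bmatrix}\begin{bmatrix}x_t\\u_t\end{bmatrix}+x_T^{\mathsf T}Q_fx_T\Bigr)\in[0,\infty],\qquad \begin{bmatrix}Q_t&S_t\\S_t^{\mathsf T}&R_t\end{bmatrix}\succeq0,\ R_t\succ0,\ Q_f\succeq0.$$ **Information graph.** Let $s^j_k=\{i\in\mathcal V: D^{ij}\le k\}$. The information graph has node set $\mathcal U=\{s^j_k: j\in\mathcal V,\ k\ge0\}$ and edges $s^j_k\to s^j_{k+1}$. Every $r\in\mathcal U$ has exactly one $s\in\mathcal U$ with $r\to s$. Write $w^i\to s$ if $s=s^i_0$. For $r,s\subseteq\mathcal V$, $M^{sr}$ is the submatrix of the blocks $M^{ij}$ with $i\in s$, $j\in r$, and $I$ is the block identity matrix. **Recursions.** For $r\in\mathcal U$, with $s$ the node such that $r\to s$, put $X_T^r=Q_f^{rr}$ and, for $t=T-1,\dots,0$, $$\Omega_t^r=R_t^{rr}+(B_t^{sr})^{\mathsf T}X_{t+1}^sB_t^{sr},\qquad K_t^r=-(\Omega_t^r)^{-1}\bigl(S_t^{rr}+(A_t^{sr})^{\mathsf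 T}X_{t+1}^sB_t^{sr}\bigr)^{\mathsf T},$$ $$X_t^r=Q_t^{rr}+(A_t^{sr})^{\mathsf T}X_{t+1}^sA_t^{sr}-(K_t^r)^{\mathsf T}\Omega_t^rK_t^r,$$ and define $$\zeta_0^s=\sum_{w^i\to s}I^{s,\{i\}}x_0^i,\qquad \zeta_{t+1}^s=\sum_{r\to s}\bigl(A_t^{sr}+B_t^{sr}K_t^r\bigr)\zeta_t^r+\sum_{w^i\to s}I^{s,\{i\}}w_t^i .$$ **Theorem.** All $\Omega_t^r$ are invertible. There is an admissible policy that generates the inputs $$u_t^i=\sum_{r\ni i}I^{\{i\},r}K_t^r\zeta_t^r\qquad(i\in\mathcal V,\ 0\le t<T),$$ and it is optimal. It is unique: every optimal admissible policy generates these inputs almost surely. The minimal cost is $$V_0=\sum_{\substack{i\in\mathcal V\\ w^i\to s}}\operatorname{tr}\bigl((X_0^s)^{\{i\},\{i\}}\Sigma_0^i\bigr)+\sum_{t=0}^{T-1}\sum_{\substack{i\in\mathcal V\\ w^i\to s}}\operatorname{tr}\bigl((X_{t+1}^s)^{\{i\},\{i\}}W_t^i\bigr).$$ -/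

import Mathlib

open MeasureTheory ProbabilityTheory Matrix
open scoped ENNReal

noncomputable section

/-! ## Network graphs, delay matrices and information graphs -/

/-- A network graph: a directed graph each of whose edges `j → i` carries a delay `0` or `1`.
The value `delay j i` has a meaning only when `j → i` is an edge. -/
structure NetworkGraph (V : Type*) extends Digraph V where
  delay : V → V → Fin 2

namespace NetworkGraph

variable {V : Type*} (G : NetworkGraph V)

/-- `G.Path j i m`: there is a directed path from `j` to `i` (possibly of length zero, possibly
revisiting vertices) whose total delay is `m`. -/
inductive Path : V → V → ℕ → Prop
  | nil (j : V) : Path j j 0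
  | cons {j l i : V} {m : ℕ} : Path j l m → G.Adj l i → Path j i (m + (G.delay l i : ℕ))

/-- There is no directed cycle (closed path with at least one edge) of total delay zero. -/
def NoDelayFreeCycle : Prop :=
  ∀ (j i : V) (m : ℕ), G.Path j i m → G.Adj i j → 0 < m + (G.delay i j : ℕ)

/-- The delay matrix: `G.D i j` is the smallest total delay of a directed path from `j` to `i`,
and `∞` if there is none. The path of length zero gives `G.D i i = 0`. -/
def D (i j : V) : ℕ∞ := ⨅ (m : ℕ) (_ : G.Path j i m), (m : ℕ∞)

theorem D_le_iff (i j : V) (k : ℕ) : G.D i j ≤ k ↔ ∃ m ≤ k, G.Path j i m := by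
  constructor
  · intro h
    by_contra hc
    push Not at hc
    have h1 : ((k + 1 : ℕ) : ℕ∞) ≤ G.D i j := by
      refine le_iInf fun m => le_iInf fun hm => ?_
      have : k < m := by
        by_contra hk
        exact hc m (by omega) hm
      exact_mod_cast this
    have h2 := h1.trans h
    have h3 : k + 1 ≤ k := by exact_mod_cast h2
    omega
  · rintro ⟨m, hm, hp⟩
    exact (iInf₂_le m hp).trans (by exact_mod_cast hm)

theorem Path.trans {j l i : V} {m m' : ℕ} (h : G.Path j l m) (h' : G.Path l i m') :
    G.Path j i (m + m') := by
  induction h' with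
  | nil => simpa using h
  | cons _ ha ih => rw [← add_assoc]; exact ih.cons ha

theorem Path.split {j i : V} {m : ℕ} (h : G.Path j i m) {k : ℕ} (hk : m ≤ k + 1) :
    ∃ l, (∃ m' ≤ k, G.Path j l m') ∧ ∃ m' ≤ 1, G.Path l i m' := by
  induction h with
  | nil => exact ⟨j, ⟨0, by omega, .nil j⟩, 0, by omega, .nil j⟩
  | @cons l i m hp ha ih =>
    have hd : (G.delay l i : ℕ) = 0 ∨ (G.delay l i : ℕ) = 1 := by omega
    rcases hd with hd | hd
    · obtain ⟨l', h1, m', hm', h2⟩ := ih (by omega)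
      exact ⟨l', h1, m' + (G.delay l i : ℕ), by omega, h2.cons ha⟩
    · exact ⟨l, ⟨m, by omega, hp⟩, 0 + (G.delay l i : ℕ), by omega, (Path.nil l).cons ha⟩

/-- The indices `(k, j)` of the states `x_k^j` in the information set of controller `i` at time
`t`, that is, those with `0 ≤ k ≤ t - D^{ij}`. -/
def InfoSet (t : ℕ) (i : V) : Type _ := {q : ℕ × V // (q.1 : ℕ∞) + G.D i q.2 ≤ t}

variable {G} in
theorem InfoSet.le {t : ℕ} {i : V} (q : G.InfoSet t i) : q.1.1 ≤ t := by
  have h : (q.1.1 : ℕ∞) ≤ t := le_self_add.trans q.2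
  exact_mod_cast h

variable [Fintype V]

/-- The set of vertices that can be reached from `j` with delay at most `k`. -/
def reach (j : V) (k : ℕ) : Finset V := Finset.univ.filter fun i => G.D i j ≤ k

theorem mem_reach {i j : V} {k : ℕ} : i ∈ G.reach j k ↔ ∃ m ≤ k, G.Path j i m := by
  simp [reach, D_le_iff]

theorem mem_reach_succ {i j : V} {k : ℕ} :
    i ∈ G.reach j (k + 1) ↔ ∃ l ∈ G.reach j k, i ∈ G.reach l 1 := by
  simp only [mem_reach]
  constructor
  · rintro ⟨m, hm, hp⟩
    exact hp.split G hm
  · rintro ⟨l, ⟨m, hm, hp⟩, m', hm', hp'⟩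
    exact ⟨m + m', by omega, hp.trans G hp'⟩

/-- The nodes of the information graph: all sets `reach j k`. -/
def InfoNode : Type _ := {s : Finset V // ∃ (j : V) (k : ℕ), s = G.reach j k}

instance : Finite G.InfoNode := Subtype.finite

instance : Fintype G.InfoNode := Fintype.ofFinite _

/-- The edges of the information graph: `reach j k → reach j (k + 1)`. -/
def InfoEdge (r s : G.InfoNode) : Prop :=
  ∃ (j : V) (k : ℕ), r.1 = G.reach j k ∧ s.1 = G.reach j (k + 1)

theorem existsUnique_infoEdge (r : G.InfoNode) : ∃! s : G.InfoNode, G.InfoEdge r s := by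
  obtain ⟨r, j, k, rfl⟩ := r
  refine ⟨⟨G.reach j (k + 1), j, k + 1, rfl⟩, ⟨j, k, rfl, rfl⟩, ?_⟩
  rintro ⟨s, hs⟩ ⟨j', k', h1, h2⟩
  apply Subtype.ext
  change s = _
  change s = _ at h2
  change G.reach j k = _ at h1
  rw [h2]
  ext i
  rw [mem_reach_succ, mem_reach_succ, h1]

/-- The unique node `s` of the information graph with `r → s`. -/
def next (r : G.InfoNode) : G.InfoNode := (G.existsUnique_infoEdge r).choose

theorem infoEdge_iff (r s : G.InfoNode) : G.InfoEdge r s ↔ G.next r = s := by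
  have h := (G.existsUnique_infoEdge r).choose_spec
  exact ⟨fun hs => (h.2 s hs).symm, fun hs => hs ▸ h.1⟩

/-- The node `s` of the information graph with `wⁱ → s`, namely the set of vertices that can be
reached from `i` with delay zero. -/
def root (i : V) : G.InfoNode := ⟨G.reach i 0, i, 0, rfl⟩

theorem mem_root (i : V) : i ∈ (G.root i).1 := G.mem_reach.2 ⟨0, le_rfl, .nil i⟩

end NetworkGraph

/-! ## Block vectors and block matrices -/

/-- The coordinates of a stacked vector whose `i`-th block has size `n i`. -/
abbrev BlockIdx {V : Type*} (n : V → ℕ) : Type _ := Σ i : V, Fin (n i)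

/-- The coordinates that belong to the blocks `i ∈ s`. -/
abbrev SubIdx {V : Type*} (n : V → ℕ) (s : Finset V) : Type _ := {p : BlockIdx n // p.1 ∈ s}

/-- The `i`-th block of a stacked vector. -/
def block {V : Type*} {n : V → ℕ} (v : BlockIdx n → ℝ) (i : V) : Fin (n i) → ℝ := fun a => v ⟨i, a⟩

/-- The subvector of the blocks `i ∈ s` of a stacked vector. -/
def subvec {V : Type*} {n : V → ℕ} (v : BlockIdx n → ℝ) (s : Finset V) : SubIdx n s → ℝ :=
  fun p => v p.1

/-- The submatrix `M^{sr}` of the blocks `M^{ij}` with `i ∈ s`, `j ∈ r`. -/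
def submat {V : Type*} {m n : V → ℕ} (M : Matrix (BlockIdx m) (BlockIdx n) ℝ) (s r : Finset V) :
    Matrix (SubIdx m s) (SubIdx n r) ℝ :=
  M.submatrix Subtype.val Subtype.val

/-- The submatrix `I^{sr}` of the block identity matrix. -/
def idBlock {V : Type*} [DecidableEq V] (n : V → ℕ) (s r : Finset V) :
    Matrix (SubIdx n s) (SubIdx n r) ℝ :=
  submat (1 : Matrix (BlockIdx n) (BlockIdx n) ℝ) s r

/-- The diagonal block `X^{{i},{i}}`, for `i ∈ s`, of a matrix with row and column blocks in `s`. -/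
def diagBlock {V : Type*} {n : V → ℕ} {s : Finset V} (X : Matrix (SubIdx n s) (SubIdx n s) ℝ)
    (i : V) (hi : i ∈ s) : Matrix (Fin (n i)) (Fin (n i)) ℝ :=
  X.submatrix (fun a => ⟨⟨i, a⟩, hi⟩) (fun a => ⟨⟨i, a⟩, hi⟩)

/-! ## The control problem -/

/-- The data of the decentralized linear quadratic problem on a network graph, with its standing
assumptions. Block sizes may depend on time. Only times `t < T` matter for the
matrices `A t`, `B t`, `Q t`, `S t`, `R t`, `W t`. -/
structure LQProblem {V : Type*} [Fintype V] [DecidableEq V] (G : NetworkGraph V) where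
  /-- the horizon -/
  T : ℕ
  /-- `nx t i` is the size of `x_t^i` -/
  nx : ℕ → V → ℕ
  /-- `nu t i` is the size of `u_t^i` -/
  nu : ℕ → V → ℕ
  A : ∀ t, Matrix (BlockIdx (nx (t + 1))) (BlockIdx (nx t)) ℝ
  B : ∀ t, Matrix (BlockIdx (nx (t + 1))) (BlockIdx (nu t)) ℝ
  Q : ∀ t, Matrix (BlockIdx (nx t)) (BlockIdx (nx t)) ℝ
  S : ∀ t, Matrix (BlockIdx (nx t)) (BlockIdx (nu t)) ℝ
  R : ∀ t, Matrix (BlockIdx (nu t)) (BlockIdx (nu t)) ℝ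
  Qf : Matrix (BlockIdx (nx T)) (BlockIdx (nx T)) ℝ
  /-- covariance of `x_0^i` -/
  Sigma0 : ∀ i, Matrix (Fin (nx 0 i)) (Fin (nx 0 i)) ℝ
  /-- covariance of `w_t^i` -/
  W : ∀ t i, Matrix (Fin (nx (t + 1) i)) (Fin (nx (t + 1) i)) ℝ
  A_zero : ∀ t < T, ∀ i j, 1 < G.D i j → ∀ a b, A t ⟨i, a⟩ ⟨j, b⟩ = 0
  B_zero : ∀ t < T, ∀ i j, 1 < G.D i j → ∀ a b, B t ⟨i, a⟩ ⟨j, b⟩ = 0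
  cost_posSemidef : ∀ t < T, (fromBlocks (Q t) (S t) (S t)ᵀ (R t)).PosSemidef
  R_posDef : ∀ t < T, (R t).PosDef
  Qf_posSemidef : Qf.PosSemidef
  Sigma0_posSemidef : ∀ i, (Sigma0 i).PosSemidef
  W_posSemidef : ∀ t < T, ∀ i, (W t i).PosSemidef

namespace LQProblem

variable {V : Type*} [Fintype V] [DecidableEq V] {G : NetworkGraph V} (p : LQProblem G)
variable {Ω : Type*}

/-- The primitive random vectors: `x_0` at time `0` and `w_t` at time `t + 1`. -/
def primitive (x0 : Ω → BlockIdx (p.nx 0) → ℝ) (w : ∀ t, Ω → BlockIdx (p.nx (t + 1)) → ℝ) :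
    ∀ k, Ω → BlockIdx (p.nx k) → ℝ
  | 0 => x0
  | t + 1 => w t

/-- The random vectors `x_0^i`, `w_t^i` (`t < T`, `i ∈ V`) are mutually independent, with laws
`N(0, Σ_0^i)` and `N(0, W_t^i)`. -/
structure IsNoise [MeasurableSpace Ω] (P : Measure Ω) (x0 : Ω → BlockIdx (p.nx 0) → ℝ)
    (w : ∀ t, Ω → BlockIdx (p.nx (t + 1)) → ℝ) : Prop where
  measurable_x0 : Measurable x0
  measurable_w : ∀ t < p.T, Measurable (w t)
  law_x0 : ∀ i, HasLaw (fun ω => WithLp.toLp 2 (block (x0 ω) i))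
    (multivariateGaussian 0 (p.Sigma0 i)) P
  law_w : ∀ t < p.T, ∀ i, HasLaw (fun ω => WithLp.toLp 2 (block (w t ω) i))
    (multivariateGaussian 0 (p.W t i)) P
  indep : iIndepFun
    (fun (q : Fin (p.T + 1) × V) (ω : Ω) => block (p.primitive x0 w q.1 ω) q.2) P

/-- An admissible policy: measurable functions `γ_t^i` of the states in the information set of
controller `i` at time `t`. -/
structure Policy where
  toFun : ∀ (t : ℕ) (i : V), (∀ q : G.InfoSet t i, Fin (p.nx q.1.1 q.1.2) → ℝ) →
    Fin (p.nu t i) → ℝ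
  measurable : ∀ t i, Measurable (toFun t i)

variable {p}

/-- The state `x_t` produced by the policy `γ` from the initial state `x₀` and the disturbances
`w_0, w_1, …`: `x_0 = x₀` and `x_{t+1} = A_t x_t + B_t u_t + w_t` where `u_t^i = γ_t^i(I_t^i)`. -/
def state (γ : p.Policy) (x0 : BlockIdx (p.nx 0) → ℝ) (w : ∀ t, BlockIdx (p.nx (t + 1)) → ℝ) :
    ∀ t, BlockIdx (p.nx t) → ℝ
  | 0 => x0
  | t + 1 =>
    p.A t *ᵥ state γ x0 w t
      + p.B t *ᵥ (fun b => γ.toFun t b.1 (fun q => block (state γ x0 w q.1.1) q.1.2) b.2)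
      + w t
  termination_by t => t
  decreasing_by
    · exact Nat.lt_succ_self t
    · exact Nat.lt_succ_of_le q.le

/-- The input `u_t`, with blocks `u_t^i = γ_t^i(I_t^i)`. -/
def input (γ : p.Policy) (x0 : BlockIdx (p.nx 0) → ℝ) (w : ∀ t, BlockIdx (p.nx (t + 1)) → ℝ)
    (t : ℕ) : BlockIdx (p.nu t) → ℝ :=
  fun b => γ.toFun t b.1 (fun q => block (state γ x0 w q.1.1) q.1.2) b.2

variable (p)

/-- The quadratic cost of a state and input trajectory. -/
def pathCost (x : ∀ t, BlockIdx (p.nx t) → ℝ) (u : ∀ t, BlockIdx (p.nu t) → ℝ) : ℝ :=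
  ∑ t ∈ Finset.range p.T,
      Sum.elim (x t) (u t) ⬝ᵥ
        (fromBlocks (p.Q t) (p.S t) (p.S t)ᵀ (p.R t) *ᵥ Sum.elim (x t) (u t))
    + x p.T ⬝ᵥ (p.Qf *ᵥ x p.T)

variable {p}

/-- The expected cost of a policy. The cost of a trajectory is nonnegative, so the expectation is
taken in `[0, ∞]`. -/
def expectedCost [MeasurableSpace Ω] (P : Measure Ω) (x0 : Ω → BlockIdx (p.nx 0) → ℝ)
    (w : ∀ t, Ω → BlockIdx (p.nx (t + 1)) → ℝ) (γ : p.Policy) : ℝ≥0∞ :=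
  ∫⁻ ω, ENNReal.ofReal
    (p.pathCost (state γ (x0 ω) fun t => w t ω) (input γ (x0 ω) fun t => w t ω)) ∂P

/-- The policy `γ` minimizes the expected cost among all admissible policies. -/
def IsOptimal [MeasurableSpace Ω] (P : Measure Ω) (x0 : Ω → BlockIdx (p.nx 0) → ℝ)
    (w : ∀ t, Ω → BlockIdx (p.nx (t + 1)) → ℝ) (γ : p.Policy) : Prop :=
  ∀ γ' : p.Policy, expectedCost P x0 w γ ≤ expectedCost P x0 w γ'

variable (p)

/-! ## The Riccati recursion along the information graph -/

/-- `Ω_t^r` in terms of `X_{t+1}`. -/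
def omegaStep (t : ℕ)
    (X' : ∀ s : G.InfoNode, Matrix (SubIdx (p.nx (t + 1)) s.1) (SubIdx (p.nx (t + 1)) s.1) ℝ)
    (r : G.InfoNode) : Matrix (SubIdx (p.nu t) r.1) (SubIdx (p.nu t) r.1) ℝ :=
  submat (p.R t) r.1 r.1
    + (submat (p.B t) (G.next r).1 r.1)ᵀ * X' (G.next r) * submat (p.B t) (G.next r).1 r.1

/-- `K_t^r` in terms of `X_{t+1}`. -/
def gainStep (t : ℕ)
    (X' : ∀ s : G.InfoNode, Matrix (SubIdx (p.nx (t + 1)) s.1) (SubIdx (p.nx (t + 1)) s.1) ℝ)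
    (r : G.InfoNode) : Matrix (SubIdx (p.nu t) r.1) (SubIdx (p.nx t) r.1) ℝ :=
  -(p.omegaStep t X' r)⁻¹ *
    (submat (p.S t) r.1 r.1
      + (submat (p.A t) (G.next r).1 r.1)ᵀ * X' (G.next r) * submat (p.B t) (G.next r).1 r.1)ᵀ

/-- `X_t^r` in terms of `X_{t+1}`. -/
def riccatiStep (t : ℕ)
    (X' : ∀ s : G.InfoNode, Matrix (SubIdx (p.nx (t + 1)) s.1) (SubIdx (p.nx (t + 1)) s.1) ℝ)
    (r : G.InfoNode) : Matrix (SubIdx (p.nx t) r.1) (SubIdx (p.nx t) r.1) ℝ :=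
  submat (p.Q t) r.1 r.1
    + (submat (p.A t) (G.next r).1 r.1)ᵀ * X' (G.next r) * submat (p.A t) (G.next r).1 r.1
    - (p.gainStep t X' r)ᵀ * p.omegaStep t X' r * p.gainStep t X' r

/-- The matrices `X_t^r`, `t ≤ T`, by backward recursion from `X_T^r = Q_f^{rr}`. -/
def X (t : ℕ) (ht : t ≤ p.T) :
    ∀ r : G.InfoNode, Matrix (SubIdx (p.nx t) r.1) (SubIdx (p.nx t) r.1) ℝ :=
  Nat.decreasingInduction
    (motive := fun t _ => ∀ r : G.InfoNode, Matrix (SubIdx (p.nx t) r.1) (SubIdx (p.nx t) r.1) ℝ)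
    (fun t _ X' => p.riccatiStep t X') (fun r => submat p.Qf r.1 r.1) ht

/-- The matrices `Ω_t^r`, `t < T`. -/
def Omega (t : ℕ) (ht : t < p.T) (r : G.InfoNode) :
    Matrix (SubIdx (p.nu t) r.1) (SubIdx (p.nu t) r.1) ℝ :=
  p.omegaStep t (p.X (t + 1) ht) r

/-- The gains `K_t^r`, `t < T`. -/
def K (t : ℕ) (ht : t < p.T) (r : G.InfoNode) :
    Matrix (SubIdx (p.nu t) r.1) (SubIdx (p.nx t) r.1) ℝ :=
  p.gainStep t (p.X (t + 1) ht) r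

theorem X_terminal (r : G.InfoNode) : p.X p.T le_rfl r = submat p.Qf r.1 r.1 := by
  simp [X]

theorem X_recursion (t : ℕ) (ht : t < p.T) (r s : G.InfoNode) (hrs : G.InfoEdge r s) :
    p.X t ht.le r =
      submat (p.Q t) r.1 r.1
        + (submat (p.A t) s.1 r.1)ᵀ * p.X (t + 1) ht s * submat (p.A t) s.1 r.1
        - (p.K t ht r)ᵀ * p.Omega t ht r * p.K t ht r := by
  obtain rfl := (G.infoEdge_iff r s).1 hrs
  unfold X
  rw [Nat.decreasingInduction_succ_left _ _ ht]
  rfl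

theorem Omega_eq (t : ℕ) (ht : t < p.T) (r s : G.InfoNode) (hrs : G.InfoEdge r s) :
    p.Omega t ht r =
      submat (p.R t) r.1 r.1
        + (submat (p.B t) s.1 r.1)ᵀ * p.X (t + 1) ht s * submat (p.B t) s.1 r.1 := by
  obtain rfl := (G.infoEdge_iff r s).1 hrs
  rfl

theorem K_eq (t : ℕ) (ht : t < p.T) (r s : G.InfoNode) (hrs : G.InfoEdge r s) :
    p.K t ht r =
      -(p.Omega t ht r)⁻¹ * (submat (p.S t) r.1 r.1
        + (submat (p.A t) s.1 r.1)ᵀ * p.X (t + 1) ht s * submat (p.B t) s.1 r.1)ᵀ := by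
  obtain rfl := (G.infoEdge_iff r s).1 hrs
  rfl

open Classical in
/-- The controller states `ζ_t^s`, `t ≤ T`, driven by the initial state and the disturbances. -/
def zeta (x0 : BlockIdx (p.nx 0) → ℝ) (w : ∀ t, BlockIdx (p.nx (t + 1)) → ℝ) :
    ∀ (t : ℕ), t ≤ p.T → ∀ s : G.InfoNode, SubIdx (p.nx t) s.1 → ℝ
  | 0, _, s =>
    ∑ i : V with G.root i = s, idBlock (p.nx 0) s.1 {i} *ᵥ subvec x0 {i}
  | t + 1, ht, s =>
    ∑ r : G.InfoNode with G.InfoEdge r s,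
        (submat (p.A t) s.1 r.1 + submat (p.B t) s.1 r.1 * p.K t ht r) *ᵥ
          zeta x0 w t (Nat.le_of_succ_le ht) r
      + ∑ i : V with G.root i = s, idBlock (p.nx (t + 1)) s.1 {i} *ᵥ subvec (w t) {i}

/-- The input `∑_{r ∋ i} I^{{i},r} K_t^r ζ_t^r` of controller `i` at time `t < T`. -/
def optimalInput (x0 : BlockIdx (p.nx 0) → ℝ) (w : ∀ t, BlockIdx (p.nx (t + 1)) → ℝ)
    (t : ℕ) (ht : t < p.T) (i : V) : SubIdx (p.nu t) {i} → ℝ :=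
  ∑ r : G.InfoNode with i ∈ r.1,
    idBlock (p.nu t) {i} r.1 *ᵥ (p.K t ht r *ᵥ p.zeta x0 w t ht.le r)

/-- The value `V_0` given by the trace formula. -/
def optimalValue : ℝ :=
  ∑ i : V, trace (diagBlock (p.X 0 (Nat.zero_le _) (G.root i)) i (G.mem_root i) * p.Sigma0 i)
    + ∑ t : Fin p.T, ∑ i : V,
        trace (diagBlock (p.X (t + 1) t.2 (G.root i)) i (G.mem_root i) * p.W t i)

end LQProblem

end

/-!
# Optimality of the information-graph controller

The candidate optimum `u*` is generated by `LQProblem.feedback`, which rebuilds the controller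
states `ζ` from observed states: `ζ_t^r` with `i ∈ r` depends only on primitive random vectors
(initial states and disturbances) that have reached `i` by time `t`, and these can be recovered from
the information set of `i` (`observer_congr`, `input_feedback`). Along this policy
`x*_t = ∑_r I^{V,r} ζ_t^r` and `u*_t = ∑_r I^{V,r} K_t^r ζ_t^r`.

Optimality, uniqueness and the value all come from one identity, `IsNoise.integral_pathBilin`: for
*every* policy with square-integrable trajectory `(x, u)`, nonlinear ones included, the expected
bilinear cost of `(x*, u*)` against `(x, u)` equals `V_0`. The bilinear cost is a polarization of the
quadratic one, hence
`E cost(x, u) = V_0 + E cost(x - x*, u - u*)` (`IsNoise.integral_pathCost_sub`). The last term is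
nonnegative, and since `x - x*` starts at zero and `R_t ≻ 0`, it vanishes only if `u = u*` almost
surely (`input_eq_of_pathCost_sub_eq_zero`).

The identity telescopes the pairings `β_t = ∑_r E (ζ_t^r)ᵀ X_t^r x_t^r` over time. Two facts make
each step work.
* Orthogonality: `ζ_t^r` is linear in the primitive random vectors that label `r` at time `t`, while
  `x_t^i` and `u_t^i` are functions of those that have reached `i` (`measurable_state`). For `i ∉ r`
  these families are disjoint (`NetworkGraph.disjoint_known_labels`), so by independence `ζ_t^r` is
  uncorrelated with `x_t^i` and `u_t^i`, however nonlinear the policy is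
  (`IsNoise.integral_ctrlState_mul_eq_zero`). Hence only the blocks in `r` of `x_t` and `u_t` count.
* Algebra: on these blocks the Riccati recursion makes the coefficient of `u_t^r` vanish and that of
  `x_t^r` equal to `X_t^r` (`riccati_bilin`).

The new disturbances, paired with themselves, produce the traces (`IsNoise.sum_integral_entering`).
A policy of finite cost has a square-integrable trajectory because `R_t` is invertible
(`IsNoise.sqIntegrable_input_of_state`); a policy of infinite cost needs no argument.
-/

noncomputable section

/-! ### Delays and the information graph -/

namespace NetworkGraph

variable {V : Type*} (G : NetworkGraph V)

theorem D_self (i : V) : G.D i i = 0 := by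
  have h := (G.D_le_iff i i 0).2 ⟨0, le_rfl, .nil i⟩
  simpa using h

theorem D_triangle (i l j : V) : G.D i j ≤ G.D i l + G.D l j := by
  by_cases h1 : G.D i l = ⊤
  · simp [h1]
  by_cases h2 : G.D l j = ⊤
  · simp [h2]
  obtain ⟨a, ha⟩ := ENat.ne_top_iff_exists.1 h1
  obtain ⟨b, hb⟩ := ENat.ne_top_iff_exists.1 h2
  obtain ⟨m, hm, hp⟩ := (G.D_le_iff i l a).1 ha.ge
  obtain ⟨m', hm', hp'⟩ := (G.D_le_iff l j b).1 hb.ge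
  rw [← ha, ← hb]
  exact_mod_cast (G.D_le_iff i j (a + b)).2 ⟨m' + m, by omega, hp'.trans G hp⟩

/-- The pairs `(k, j)` such that the primitive random vector `j` of time `k` has reached the
vertex `i` by time `t`. -/
def known (t : ℕ) (i : V) : Set (ℕ × V) := {q | (q.1 : ℕ∞) + G.D i q.2 ≤ t}

variable {G} in
theorem le_of_mem_known {t : ℕ} {i : V} {q : ℕ × V} (h : q ∈ G.known t i) : q.1 ≤ t := by
  have h : (q.1 : ℕ∞) ≤ t := le_self_add.trans h
  exact_mod_cast h

theorem known_subset {t t' : ℕ} {i i' : V} (h : (t' : ℕ∞) + G.D i i' ≤ t) :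
    G.known t' i' ⊆ G.known t i := by
  intro q hq
  have h1 := G.D_triangle i i' q.2
  have hq' : (q.1 : ℕ∞) + G.D i' q.2 ≤ t' := hq
  calc (q.1 : ℕ∞) + G.D i q.2 ≤ q.1 + (G.D i i' + G.D i' q.2) := by gcongr
    _ = (q.1 + G.D i' q.2) + G.D i i' := by ring
    _ ≤ t' + G.D i i' := by gcongr
    _ ≤ t := h

variable [Fintype V]

theorem mem_reach_iff {i j : V} {k : ℕ} : i ∈ G.reach j k ↔ G.D i j ≤ k := by
  simp [reach]

theorem next_val_of_eq {r : G.InfoNode} {j : V} {k : ℕ} (h : r.1 = G.reach j k) :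
    (G.next r).1 = G.reach j (k + 1) := by
  have := (G.infoEdge_iff r ⟨G.reach j (k + 1), j, k + 1, rfl⟩).1 ⟨j, k, h, rfl⟩
  rw [this]

theorem mem_next_iff {r : G.InfoNode} {i : V} : i ∈ (G.next r).1 ↔ ∃ l ∈ r.1, G.D i l ≤ 1 := by
  obtain ⟨j, k, h⟩ := r.2
  rw [G.next_val_of_eq h, h, mem_reach_succ]
  simp only [mem_reach_iff, Nat.cast_one]

theorem mem_root_iff {i j : V} : i ∈ (G.root j).1 ↔ G.D i j = 0 := by
  change i ∈ G.reach j 0 ↔ _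
  simp [mem_reach_iff]

/-- The labels of the node `r` at time `t`: the pairs `(k, j)` such that the primitive random vector
`j` of time `k` (initial state for `k = 0`, disturbance `w_{k-1}` otherwise) has spread exactly to
the vertices `r` by time `t`. -/
def labels (t : ℕ) (r : G.InfoNode) : Set (ℕ × V) :=
  {q | q.1 ≤ t ∧ r.1 = G.reach q.2 (t - q.1)}

/-- A vertex outside `r` has seen none of the primitive random vectors that label `r`. -/
theorem disjoint_known_labels {t : ℕ} {i : V} {r : G.InfoNode} (hi : i ∉ r.1) :
    Disjoint (G.known t i) (G.labels t r) := by
  rw [Set.disjoint_left]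
  rintro ⟨k, j⟩ hq ⟨hk, hr⟩
  apply hi
  dsimp only at hk hr
  rw [hr, mem_reach_iff]
  have hq' : (k : ℕ∞) + G.D i j ≤ t := hq
  have hne : G.D i j ≠ ⊤ := by
    rintro h
    simp [h] at hq'
  obtain ⟨d, hd⟩ := ENat.ne_top_iff_exists.1 hne
  rw [← hd] at hq' ⊢
  have : k + d ≤ t := by exact_mod_cast hq'
  exact_mod_cast (by omega : d ≤ t - k)

/-- The pairs `(k, j)` whose primitive random vector has reached a vertex outside `r` by
time `t`. -/
def knownOutside (t : ℕ) (r : G.InfoNode) : Set (ℕ × V) :=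
  ⋃ i ∉ r.1, G.known t i

theorem disjoint_knownOutside_labels (t : ℕ) (r : G.InfoNode) :
    Disjoint (G.knownOutside t r) (G.labels t r) := by
  simp only [knownOutside, Set.disjoint_iUnion_left]
  exact fun i hi => G.disjoint_known_labels hi

theorem labels_subset_next {t : ℕ} {r : G.InfoNode} :
    G.labels t r ⊆ G.labels (t + 1) (G.next r) := by
  rintro ⟨k, j⟩ ⟨hk, hr⟩
  dsimp only at hk hr
  refine ⟨by simp; omega, ?_⟩
  rw [G.next_val_of_eq hr]
  congr 1
  simp; omega

theorem mem_labels_root (t : ℕ) (j : V) : (t, j) ∈ G.labels t (G.root j) := by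
  refine ⟨le_rfl, ?_⟩
  simp [root]

end NetworkGraph

/-! ### Embedding of subvectors -/

section Embed

variable {V : Type*} [DecidableEq V] {m n : V → ℕ}

/-- The stacked vector with blocks `v^i` for `i ∈ s` and zero blocks elsewhere, that is,
`I^{V,s} v`. -/
def embed (s : Finset V) (v : SubIdx n s → ℝ) : BlockIdx n → ℝ :=
  fun q => if h : q.1 ∈ s then v ⟨q, h⟩ else 0

theorem embed_of_mem {s : Finset V} (v : SubIdx n s → ℝ) {q : BlockIdx n} (h : q.1 ∈ s) :
    embed s v q = v ⟨q, h⟩ := dif_pos h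

theorem embed_of_notMem {s : Finset V} (v : SubIdx n s → ℝ) {q : BlockIdx n} (h : q.1 ∉ s) :
    embed s v q = 0 := dif_neg h

@[simp] theorem embed_add (s : Finset V) (v v' : SubIdx n s → ℝ) :
    embed s (v + v') = embed s v + embed s v' := by
  ext q; by_cases h : q.1 ∈ s <;> simp [embed, h]

theorem embed_sum {ι : Type*} (S : Finset ι) (s : Finset V) (v : ι → SubIdx n s → ℝ) :
    embed s (∑ c ∈ S, v c) = ∑ c ∈ S, embed s (v c) := by
  ext q
  by_cases h : q.1 ∈ s <;> simp [embed, h, Finset.sum_apply]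

variable [Fintype V]

theorem sum_embed_mul (s : Finset V) (f : BlockIdx n → ℝ) (v : SubIdx n s → ℝ) :
    ∑ q, f q * embed s v q = ∑ q : SubIdx n s, f q.1 * v q := by
  have h : ∀ q : SubIdx n s, f q.1 * v q = f q.1 * embed s v q.1 := fun q => by
    rw [embed_of_mem v q.2]
  simp_rw [h]
  rw [← Finset.sum_subtype (Finset.univ.filter fun q : BlockIdx n => q.1 ∈ s) (by simp)
    (fun q => f q * embed s v q), Finset.sum_filter]
  refine Finset.sum_congr rfl fun q _ => ?_
  by_cases hq : q.1 ∈ s <;> simp [embed, hq]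

theorem embed_dotProduct (s : Finset V) (v : SubIdx n s → ℝ) (x : BlockIdx n → ℝ) :
    embed s v ⬝ᵥ x = v ⬝ᵥ subvec x s := by
  rw [dotProduct_comm, dotProduct_comm v]
  exact sum_embed_mul s x v

theorem subvec_mulVec_embed (M : Matrix (BlockIdx m) (BlockIdx n) ℝ) (s r : Finset V)
    (v : SubIdx n r → ℝ) : subvec (M *ᵥ embed r v) s = submat M s r *ᵥ v := by
  ext q
  exact sum_embed_mul r (M q.1) v

theorem mulVec_embed {M : Matrix (BlockIdx m) (BlockIdx n) ℝ} {s r : Finset V}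
    (h : ∀ i ∉ s, ∀ j ∈ r, ∀ a b, M ⟨i, a⟩ ⟨j, b⟩ = 0) (v : SubIdx n r → ℝ) :
    M *ᵥ embed r v = embed s (submat M s r *ᵥ v) := by
  ext q
  by_cases hq : q.1 ∈ s
  · rw [embed_of_mem _ hq, ← subvec_mulVec_embed]
    rfl
  · rw [embed_of_notMem _ hq]
    refine Finset.sum_eq_zero fun q' _ => ?_
    by_cases hq' : q'.1 ∈ r
    · have : M q q' = 0 := h q.1 hq q'.1 hq' q.2 q'.2
      simp [this]
    · simp [embed_of_notMem _ hq']

theorem idBlock_mulVec (s r : Finset V) (v : SubIdx n r → ℝ) :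
    idBlock n s r *ᵥ v = subvec (embed r v) s := by
  rw [idBlock, ← subvec_mulVec_embed, one_mulVec]

end Embed

/-! ### The controller states and a policy that computes them -/

namespace LQProblem

variable {V : Type*} [Fintype V] [DecidableEq V] {G : NetworkGraph V} (p : LQProblem G)

/-- The gain `K_t^r`, continued by zero to the times `t ≥ T`. -/
def gain (t : ℕ) (r : G.InfoNode) : Matrix (SubIdx (p.nu t) r.1) (SubIdx (p.nx t) r.1) ℝ :=
  if ht : t < p.T then p.K t ht r else 0

theorem gain_eq {t : ℕ} (ht : t < p.T) (r : G.InfoNode) : p.gain t r = p.K t ht r := dif_pos ht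

/-- The stacked input `∑_r I^{V,r} K_t^r z^r`. -/
def control (t : ℕ) (z : ∀ r : G.InfoNode, SubIdx (p.nx t) r.1 → ℝ) : BlockIdx (p.nu t) → ℝ :=
  ∑ r : G.InfoNode, embed r.1 (p.gain t r *ᵥ z r)

open Classical in
/-- The part `∑_{wⁱ → s} I^{s,{i}} dⁱ` of a stacked vector that enters the node `s`. -/
def entering {n : V → ℕ} (d : BlockIdx n → ℝ) (s : G.InfoNode) : SubIdx n s.1 → ℝ :=
  fun q => if G.root q.1.1 = s then d q.1 else 0

open Classical in
/-- One step of the recursion for the controller states, driven by `d`. -/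
def zetaStep (t : ℕ) (z : ∀ r : G.InfoNode, SubIdx (p.nx t) r.1 → ℝ)
    (d : BlockIdx (p.nx (t + 1)) → ℝ) (s : G.InfoNode) : SubIdx (p.nx (t + 1)) s.1 → ℝ :=
  ∑ r : G.InfoNode with G.next r = s,
    (submat (p.A t) s.1 r.1 + submat (p.B t) s.1 r.1 * p.gain t r) *ᵥ z r + entering d s

/-- The controller states `ζ_t^s`, continued to all times. -/
def ctrlState (x0 : BlockIdx (p.nx 0) → ℝ) (w : ∀ t, BlockIdx (p.nx (t + 1)) → ℝ) :
    ∀ (t : ℕ) (s : G.InfoNode), SubIdx (p.nx t) s.1 → ℝ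
  | 0 => entering x0
  | t + 1 => p.zetaStep t (ctrlState x0 w t) (w t)

open Classical in
theorem sum_idBlock_eq_entering {n : V → ℕ} (d : BlockIdx n → ℝ) (s : G.InfoNode) :
    ∑ i : V with G.root i = s, idBlock n s.1 {i} *ᵥ subvec d {i} = entering d s := by
  ext q
  simp only [idBlock_mulVec, Finset.sum_apply, entering]
  have h : ∀ i, subvec (embed {i} (subvec d {i})) s.1 q = if i = q.1.1 then d q.1 else 0 := by
    intro i
    simp only [subvec, embed, Finset.mem_singleton]
    by_cases hi : i = q.1.1 <;> simp [hi, eq_comm]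
  simp_rw [h]
  rw [Finset.sum_ite_eq']
  simp

theorem zeta_eq_ctrlState (x0 : BlockIdx (p.nx 0) → ℝ) (w : ∀ t, BlockIdx (p.nx (t + 1)) → ℝ)
    (t : ℕ) (ht : t ≤ p.T) (s : G.InfoNode) : p.zeta x0 w t ht s = p.ctrlState x0 w t s := by
  classical
  induction t generalizing s with
  | zero => rw [zeta, ctrlState, sum_idBlock_eq_entering]
  | succ t ih =>
    rw [zeta, ctrlState, sum_idBlock_eq_entering, zetaStep]
    congr 1
    simp only [G.infoEdge_iff]
    refine Finset.sum_congr (by congr) fun r _ => ?_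
    rw [ih, p.gain_eq ht]

theorem optimalInput_eq (x0 : BlockIdx (p.nx 0) → ℝ) (w : ∀ t, BlockIdx (p.nx (t + 1)) → ℝ)
    (t : ℕ) (ht : t < p.T) (i : V) :
    p.optimalInput x0 w t ht i = subvec (p.control t (p.ctrlState x0 w t)) {i} := by
  classical
  ext q
  obtain ⟨⟨j, b⟩, hj⟩ := q
  obtain rfl : j = i := by simpa using hj
  simp only [optimalInput, subvec, control, Finset.sum_apply, idBlock_mulVec]
  rw [Finset.sum_filter]
  refine Finset.sum_congr rfl fun r _ => ?_
  rw [zeta_eq_ctrlState, p.gain_eq ht]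
  split_ifs with h
  · rfl
  · rw [embed_of_notMem _ h]

theorem control_apply_congr {t : ℕ} {z z' : ∀ r : G.InfoNode, SubIdx (p.nx t) r.1 → ℝ}
    (q : BlockIdx (p.nu t)) (h : ∀ r : G.InfoNode, q.1 ∈ r.1 → z r = z' r) :
    p.control t z q = p.control t z' q := by
  simp only [control, Finset.sum_apply]
  refine Finset.sum_congr rfl fun r _ => ?_
  by_cases hr : q.1 ∈ r.1
  · rw [h r hr]
  · rw [embed_of_notMem _ hr, embed_of_notMem _ hr]

omit [DecidableEq V] in
theorem mulVec_apply_congr {m n : V → ℕ} {M : Matrix (BlockIdx m) (BlockIdx n) ℝ}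
    (hM : ∀ i j, 1 < G.D i j → ∀ a b, M ⟨i, a⟩ ⟨j, b⟩ = 0) {v v' : BlockIdx n → ℝ}
    (q : BlockIdx m) (h : ∀ q' : BlockIdx n, G.D q.1 q'.1 ≤ 1 → v q' = v' q') :
    (M *ᵥ v) q = (M *ᵥ v') q := by
  refine Finset.sum_congr rfl fun q' _ => ?_
  rcases le_or_gt (G.D q.1 q'.1) 1 with hq | hq
  · rw [h q' hq]
  · have : M q q' = 0 := hM q.1 q'.1 hq q.2 q'.2
    simp [this]

/-- The controller states computed from a state trajectory `y`: the disturbances are recovered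
as `y_{t+1} - A_t y_t - B_t u_t`, where `u_t` is the input that the computed controller states
prescribe. -/
def observer (y : ∀ t, BlockIdx (p.nx t) → ℝ) :
    ∀ (t : ℕ) (s : G.InfoNode), SubIdx (p.nx t) s.1 → ℝ
  | 0 => entering (y 0)
  | t + 1 => p.zetaStep t (observer y t)
      (y (t + 1) - (p.A t *ᵥ y t + p.B t *ᵥ p.control t (observer y t)))

/-- The controller states of the nodes that contain `l` at time `k` need only those blocks of the
trajectory that are available to every vertex `i` with `k + D^{il} ≤ t`, at time `t`. -/
theorem observer_congr {t : ℕ} (ht : t ≤ p.T) {i : V} {y y' : ∀ t, BlockIdx (p.nx t) → ℝ}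
    (h : ∀ (k : ℕ) (q : BlockIdx (p.nx k)), (k : ℕ∞) + G.D i q.1 ≤ t → y k q = y' k q)
    (k : ℕ) : ∀ l : V, (k : ℕ∞) + G.D i l ≤ t → ∀ s : G.InfoNode, l ∈ s.1 →
      p.observer y k s = p.observer y' k s := by
  classical
  induction k with
  | zero =>
    intro l hl s hs
    ext q
    simp only [observer, entering]
    split_ifs with hq
    · have h1 : G.D l q.1.1 = 0 := by
        rw [← G.mem_root_iff, hq]
        exact hs
      refine h 0 _ (le_trans ?_ hl)
      have := G.D_triangle i l q.1.1
      rw [h1, add_zero] at this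
      gcongr
    · rfl
  | succ k ih =>
    intro l hl s hs
    have hkT : k < p.T := by
      have h1 : ((k + 1 : ℕ) : ℕ∞) ≤ t := le_self_add.trans hl
      have h2 : k + 1 ≤ t := by exact_mod_cast h1
      omega
    -- whatever is within delay one of `l` at time `k` has also arrived at `i`
    have hstep : ∀ m, G.D l m ≤ 1 → (k : ℕ∞) + G.D i m ≤ t := fun m hm => by
      calc (k : ℕ∞) + G.D i m ≤ k + (G.D i l + G.D l m) := by
            gcongr; exact G.D_triangle i l m
        _ ≤ k + (G.D i l + 1) := by gcongr
        _ = (k + 1 : ℕ) + G.D i l := by push_cast; ring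
        _ ≤ t := hl
    simp only [observer, zetaStep]
    congr 1
    · refine Finset.sum_congr rfl fun r hr => ?_
      obtain rfl := (Finset.mem_filter.1 hr).2
      obtain ⟨m, hm, hlm⟩ := G.mem_next_iff.1 hs
      rw [ih m (hstep m hlm) r hm]
    · ext q
      simp only [entering]
      split_ifs with hq
      · have h1 : G.D l q.1.1 = 0 := by
          rw [← G.mem_root_iff, hq]
          exact hs
        have h2 : ∀ m, G.D q.1.1 m ≤ 1 → G.D l m ≤ 1 := fun m hm => by
          refine (G.D_triangle l q.1.1 m).trans ?_
          rwa [h1, zero_add]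
        simp only [Pi.sub_apply, Pi.add_apply]
        congr 1
        · refine h (k + 1) _ (le_trans ?_ hl)
          have := G.D_triangle i l q.1.1
          rw [h1, add_zero] at this
          gcongr
        · congr 1
          · exact mulVec_apply_congr (p.A_zero k hkT) _ fun q' hq' =>
              h k q' (hstep _ (h2 _ hq'))
          · exact mulVec_apply_congr (p.B_zero k hkT) _ fun q' hq' =>
              p.control_apply_congr q' fun r hr => ih q'.1 (hstep _ (h2 _ hq')) r hr
      · rfl

open Classical in
/-- The trajectory whose blocks are those of the given information set, and zero elsewhere. -/
def zeroExtend {t : ℕ} {i : V} (y : ∀ q : G.InfoSet t i, Fin (p.nx q.1.1 q.1.2) → ℝ) (k : ℕ) :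
    BlockIdx (p.nx k) → ℝ :=
  fun q => if h : (k : ℕ∞) + G.D i q.1 ≤ t then y ⟨(k, q.1), h⟩ q.2 else 0

theorem measurable_mulVec_apply {Y ι κ : Type*} {mY : MeasurableSpace Y} [Fintype κ]
    (M : Matrix ι κ ℝ) {f : Y → κ → ℝ} (a : ι) (hf : ∀ b, M a b ≠ 0 → Measurable fun y => f y b) :
    Measurable fun y => (M *ᵥ f y) a := by
  simp only [mulVec, dotProduct]
  refine Finset.measurable_sum _ fun b _ => ?_
  by_cases hb : M a b = 0
  · simp [hb]
  · exact (hf b hb).const_mul _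

theorem measurable_control {Y : Type*} [MeasurableSpace Y] {t : ℕ}
    {z : Y → ∀ r : G.InfoNode, SubIdx (p.nx t) r.1 → ℝ}
    (hz : ∀ r q, Measurable fun y => z y r q) (q : BlockIdx (p.nu t)) :
    Measurable fun y => p.control t (z y) q := by
  simp only [control, Finset.sum_apply]
  refine Finset.measurable_sum _ fun r _ => ?_
  by_cases hr : q.1 ∈ r.1
  · simp only [embed_of_mem _ hr]
    exact measurable_mulVec_apply _ _ fun b _ => hz r b
  · simp only [embed_of_notMem _ hr]
    exact measurable_const

omit [DecidableEq V] in
theorem measurable_entering {Y : Type*} [MeasurableSpace Y] {n : V → ℕ} {d : Y → BlockIdx n → ℝ}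
    (s : G.InfoNode) (q : SubIdx n s.1)
    (hd : G.root q.1.1 = s → Measurable fun y => d y q.1) :
    Measurable fun y => entering (d y) s q := by
  simp only [entering]
  split_ifs with h
  · exact hd h
  · exact measurable_const

theorem measurable_zetaStep {Y : Type*} [MeasurableSpace Y] {t : ℕ}
    {z : Y → ∀ r : G.InfoNode, SubIdx (p.nx t) r.1 → ℝ} {d : Y → BlockIdx (p.nx (t + 1)) → ℝ}
    (s : G.InfoNode) (q : SubIdx (p.nx (t + 1)) s.1)
    (hz : ∀ r, G.next r = s → ∀ q, Measurable fun y => z y r q)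
    (hd : G.root q.1.1 = s → Measurable fun y => d y q.1) :
    Measurable fun y => p.zetaStep t (z y) (d y) s q := by
  classical
  simp only [zetaStep, Pi.add_apply, Finset.sum_apply]
  refine Measurable.add ?_ (measurable_entering s q hd)
  refine Finset.measurable_sum _ fun r hr => ?_
  exact measurable_mulVec_apply _ _ fun b _ => hz r (Finset.mem_filter.1 hr).2 b

theorem measurable_observer {Y : Type*} [MeasurableSpace Y] {y : Y → ∀ t, BlockIdx (p.nx t) → ℝ}
    (hy : ∀ t q, Measurable fun c => y c t q) (t : ℕ) (s : G.InfoNode) (q : SubIdx (p.nx t) s.1) :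
    Measurable fun c => p.observer (y c) t s q := by
  induction t generalizing s with
  | zero => exact measurable_entering s q fun _ => hy 0 q.1
  | succ t ih =>
    refine p.measurable_zetaStep s q (fun r _ => ih r) fun _ => ?_
    refine (hy _ _).sub (Measurable.add ?_ ?_)
    · exact measurable_mulVec_apply _ _ fun b _ => hy t b
    · exact measurable_mulVec_apply _ _ fun b _ => p.measurable_control ih b

/-- The policy in which vertex `i` computes controller states from its information set and applies
the prescribed input. Unavailable blocks are set to zero; by `observer_congr` they do not affect
block `i` of the input. -/
def feedback : p.Policy where
  toFun t i y a := p.control t (p.observer (p.zeroExtend y) t) ⟨i, a⟩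
  measurable t i := by
    refine measurable_pi_lambda _ fun a => p.measurable_control (fun r q => ?_) _
    refine p.measurable_observer (fun k q => ?_) t r q
    simp only [zeroExtend]
    split_ifs with h
    · exact (measurable_pi_apply _).comp (measurable_pi_apply _)
    · exact measurable_const

variable {p}

theorem state_succ (γ : p.Policy) (x0 : BlockIdx (p.nx 0) → ℝ)
    (w : ∀ t, BlockIdx (p.nx (t + 1)) → ℝ) (t : ℕ) :
    state γ x0 w (t + 1) = p.A t *ᵥ state γ x0 w t + p.B t *ᵥ input γ x0 w t + w t := by
  rw [state]
  rfl

variable (p)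

theorem input_feedback_observer (x0 : BlockIdx (p.nx 0) → ℝ)
    (w : ∀ t, BlockIdx (p.nx (t + 1)) → ℝ) {t : ℕ} (ht : t ≤ p.T) :
    input p.feedback x0 w t = p.control t (p.observer (state p.feedback x0 w) t) := by
  ext ⟨i, a⟩
  refine p.control_apply_congr _ fun r hr => ?_
  refine p.observer_congr ht (i := i) (fun k q hq => ?_) t i ?_ r hr
  · exact dif_pos hq
  · simp [G.D_self]

theorem observer_state_feedback (x0 : BlockIdx (p.nx 0) → ℝ)
    (w : ∀ t, BlockIdx (p.nx (t + 1)) → ℝ) {t : ℕ} (ht : t ≤ p.T) :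
    p.observer (state p.feedback x0 w) t = p.ctrlState x0 w t := by
  induction t with
  | zero => rw [observer, ctrlState, state]
  | succ t ih =>
    have ht' := Nat.le_of_succ_le ht
    rw [observer, ctrlState, state_succ, input_feedback_observer p x0 w ht', ih ht',
      add_sub_cancel_left]

/-- The feedback policy generates the inputs `∑_r I^{V,r} K_t^r ζ_t^r`. -/
theorem input_feedback (x0 : BlockIdx (p.nx 0) → ℝ) (w : ∀ t, BlockIdx (p.nx (t + 1)) → ℝ)
    {t : ℕ} (ht : t ≤ p.T) :
    input p.feedback x0 w t = p.control t (p.ctrlState x0 w t) := by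
  rw [input_feedback_observer p x0 w ht, observer_state_feedback p x0 w ht]

theorem sum_embed_entering {n : V → ℕ} (d : BlockIdx n → ℝ) :
    ∑ s : G.InfoNode, embed s.1 (entering d s) = d := by
  classical
  ext q
  rw [Finset.sum_apply, Finset.sum_eq_single (G.root q.1)]
  · rw [embed_of_mem _ (G.mem_root q.1)]
    simp [entering]
  · intro s _ hs
    by_cases h : q.1 ∈ s.1
    · rw [embed_of_mem _ h]
      simp [entering, hs.symm]
    · exact embed_of_notMem _ h
  · simp

omit [DecidableEq V] in
theorem sum_fiber_next {M : Type*} [AddCommMonoid M] (f : G.InfoNode → G.InfoNode → M) :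
    open Classical in
    ∑ s : G.InfoNode, ∑ r : G.InfoNode with G.next r = s, f s r = ∑ r, f (G.next r) r := by
  classical
  simp only [Finset.sum_filter]
  rw [Finset.sum_comm]
  simp

theorem mulVec_embed_next {m n : V → ℕ} {M : Matrix (BlockIdx m) (BlockIdx n) ℝ}
    (hM : ∀ i j, 1 < G.D i j → ∀ a b, M ⟨i, a⟩ ⟨j, b⟩ = 0) (r : G.InfoNode)
    (v : SubIdx n r.1 → ℝ) :
    M *ᵥ embed r.1 v = embed (G.next r).1 (submat M (G.next r).1 r.1 *ᵥ v) := by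
  refine mulVec_embed (fun i hi j hj => hM i j ?_) v
  by_contra h
  exact hi (G.mem_next_iff.2 ⟨j, hj, not_lt.1 h⟩)

/-- Along the feedback policy the state is `∑_r I^{V,r} ζ_t^r`. -/
theorem state_feedback (x0 : BlockIdx (p.nx 0) → ℝ) (w : ∀ t, BlockIdx (p.nx (t + 1)) → ℝ)
    {t : ℕ} (ht : t ≤ p.T) :
    state p.feedback x0 w t = ∑ r : G.InfoNode, embed r.1 (p.ctrlState x0 w t r) := by
  classical
  induction t with
  | zero => rw [state, ctrlState, sum_embed_entering]
  | succ t ih =>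
    rw [state_succ, input_feedback p x0 w (by omega), ih (by omega), control, ctrlState]
    simp only [zetaStep, embed_add, embed_sum, Finset.sum_add_distrib, sum_embed_entering]
    congr 1
    rw [sum_fiber_next (fun s r => embed s.1 ((submat (p.A t) s.1 r.1 +
      submat (p.B t) s.1 r.1 * p.gain t r) *ᵥ p.ctrlState x0 w t r)), mulVec_sum, mulVec_sum,
      ← Finset.sum_add_distrib]
    refine Finset.sum_congr rfl fun r _ => ?_
    rw [mulVec_embed_next (p.A_zero t ht), mulVec_embed_next (p.B_zero t ht), add_mulVec, embed_add,
      mulVec_mulVec]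

end LQProblem

/-! ### The Riccati recursion -/

section Riccati

variable {l m n : Type*} [Fintype l] [Fintype m] [Fintype n]

theorem Matrix.PosSemidef.dotProduct_mulVec_self_nonneg {M : Matrix n n ℝ}
    (hM : M.PosSemidef) (v : n → ℝ) : 0 ≤ v ⬝ᵥ (M *ᵥ v) := by
  simpa using hM.dotProduct_mulVec_nonneg v

theorem mulVec_dotProduct_eq (M : Matrix m n ℝ) (v : n → ℝ) (y : m → ℝ) :
    (M *ᵥ v) ⬝ᵥ y = v ⬝ᵥ (Mᵀ *ᵥ y) := by
  rw [dotProduct_comm, dotProduct_mulVec, dotProduct_comm, ← mulVec_transpose]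

theorem sum_dotProduct_fromBlocks (Q : Matrix m m ℝ) (S : Matrix m n ℝ) (R : Matrix n n ℝ)
    (z x : m → ℝ) (v u : n → ℝ) :
    Sum.elim z v ⬝ᵥ (fromBlocks Q S Sᵀ R *ᵥ Sum.elim x u) =
      z ⬝ᵥ (Q *ᵥ x) + z ⬝ᵥ (S *ᵥ u) + (v ⬝ᵥ (Sᵀ *ᵥ x) + v ⬝ᵥ (R *ᵥ u)) := by
  rw [fromBlocks_mulVec, sumElim_dotProduct_sumElim, dotProduct_add, dotProduct_add]
  rfl

variable {A : Matrix l m ℝ} {B : Matrix l n ℝ} {Q : Matrix m m ℝ}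
  {S : Matrix m n ℝ} {R : Matrix n n ℝ} {X : Matrix l l ℝ} {K : Matrix n m ℝ}

theorem posDef_add_transpose_mul_mul (hR : R.PosDef) (hX : X.PosSemidef) :
    (R + Bᵀ * X * B).PosDef := by
  have h := hX.conjTranspose_mul_mul_same B
  rw [conjTranspose_eq_transpose_of_trivial] at h
  exact hR.add_posSemidef h

variable [DecidableEq n]

/-- The polarized completion of squares: when the first argument uses the optimal gain, one step of
the bilinear cost followed by `X` collapses to the Riccati update of `X`, whatever the input `u`
in the second argument. -/
theorem riccati_bilin (hR : R.PosDef) (hX : X.PosSemidef)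
    (hK : K = -(R + Bᵀ * X * B)⁻¹ * (S + Aᵀ * X * B)ᵀ) (z x : m → ℝ) (u : n → ℝ) :
    Sum.elim z (K *ᵥ z) ⬝ᵥ (fromBlocks Q S Sᵀ R *ᵥ Sum.elim x u)
        + ((A + B * K) *ᵥ z) ⬝ᵥ (X *ᵥ (A *ᵥ x + B *ᵥ u)) =
      z ⬝ᵥ ((Q + Aᵀ * X * A - Kᵀ * (R + Bᵀ * X * B) * K) *ᵥ x) := by
  have hΩ := posDef_add_transpose_mul_mul (B := B) hR hX
  have hΩu : IsUnit (R + Bᵀ * X * B).det := (isUnit_iff_isUnit_det _).1 hΩ.isUnit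
  have hΩt : (R + Bᵀ * X * B)ᵀ = R + Bᵀ * X * B := by
    simpa using hΩ.isHermitian.eq
  have h1 : (R + Bᵀ * X * B) * K = -(S + Aᵀ * X * B)ᵀ := by
    rw [hK, Matrix.neg_mul, Matrix.mul_neg, ← Matrix.mul_assoc, mul_nonsing_inv _ hΩu,
      Matrix.one_mul]
  have h2 : Kᵀ * (R + Bᵀ * X * B) = -(S + Aᵀ * X * B) := by
    have := congrArg transpose h1
    rwa [transpose_mul, hΩt, transpose_neg, transpose_transpose] at this
  have hXt : Xᵀ = X := by simpa using hX.isHermitian.eq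
  have hu : S + Kᵀ * R + (A + B * K)ᵀ * X * B = 0 := by
    have : S + Kᵀ * R + (A + B * K)ᵀ * X * B
        = S + Aᵀ * X * B + Kᵀ * (R + Bᵀ * X * B) := by
      simp only [transpose_add, transpose_mul, Matrix.add_mul, Matrix.mul_add, Matrix.mul_assoc]
      abel
    rw [this, h2, add_neg_cancel]
  have hx : Q + Kᵀ * Sᵀ + (A + B * K)ᵀ * X * A =
      Q + Aᵀ * X * A - Kᵀ * (R + Bᵀ * X * B) * K := by
    rw [Matrix.mul_assoc Kᵀ, h1]
    simp only [transpose_add, transpose_mul, transpose_transpose, hXt, Matrix.add_mul,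
      Matrix.mul_add, Matrix.mul_neg, Matrix.mul_assoc]
    abel
  rw [sum_dotProduct_fromBlocks, ← hx]
  have hz : z ⬝ᵥ ((S + Kᵀ * R + (A + B * K)ᵀ * X * B) *ᵥ u) = 0 := by rw [hu]; simp
  simp only [mulVec_dotProduct_eq, mulVec_add, dotProduct_add, mulVec_mulVec] at hz ⊢
  simp only [add_mulVec, dotProduct_add, Matrix.mul_assoc] at hz ⊢
  linarith

theorem riccati_posSemidef (hQ : (fromBlocks Q S Sᵀ R).PosSemidef) (hR : R.PosDef)
    (hX : X.PosSemidef) (hK : K = -(R + Bᵀ * X * B)⁻¹ * (S + Aᵀ * X * B)ᵀ) :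
    (Q + Aᵀ * X * A - Kᵀ * (R + Bᵀ * X * B) * K).PosSemidef := by
  refine PosSemidef.of_dotProduct_mulVec_nonneg ?_ fun z => ?_
  · have hQt : Qᵀ = Q := (hQ.submatrix Sum.inl).isHermitian.eq
    have hRt : Rᵀ = R := by simpa using hR.isHermitian.eq
    have hXt : Xᵀ = X := by simpa using hX.isHermitian.eq
    simp [IsHermitian, conjTranspose_eq_transpose_of_trivial, hQt, hRt, hXt, Matrix.mul_assoc]
  · rw [star_trivial, ← riccati_bilin hR hX hK z z (K *ᵥ z)]
    have h : A *ᵥ z + B *ᵥ (K *ᵥ z) = (A + B * K) *ᵥ z := by rw [add_mulVec, mulVec_mulVec]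
    rw [h]
    exact add_nonneg (hQ.dotProduct_mulVec_self_nonneg _) (hX.dotProduct_mulVec_self_nonneg _)

end Riccati

namespace LQProblem

variable {V : Type*} [Fintype V] [DecidableEq V] {G : NetworkGraph V} (p : LQProblem G)

theorem submat_R_posDef {t : ℕ} (ht : t < p.T) (r : Finset V) : (submat (p.R t) r r).PosDef :=
  (p.R_posDef t ht).submatrix Subtype.val_injective

theorem submat_cost_posSemidef {t : ℕ} (ht : t < p.T) (r : Finset V) :
    (fromBlocks (submat (p.Q t) r r) (submat (p.S t) r r) (submat (p.S t) r r)ᵀ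
      (submat (p.R t) r r)).PosSemidef := by
  convert (p.cost_posSemidef t ht).submatrix
    (Sum.map (Subtype.val (p := fun q : BlockIdx (p.nx t) => q.1 ∈ r))
      (Subtype.val (p := fun q : BlockIdx (p.nu t) => q.1 ∈ r))) using 1
  ext (a | a) (b | b) <;> rfl

theorem X_posSemidef (t : ℕ) (ht : t ≤ p.T) (r : G.InfoNode) : (p.X t ht r).PosSemidef := by
  induction ht using Nat.decreasingInduction generalizing r with
  | self =>
    rw [X_terminal]
    exact p.Qf_posSemidef.submatrix _
  | of_succ t ht ih =>
    have hrs : G.InfoEdge r (G.next r) := (G.infoEdge_iff r _).2 rfl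
    rw [p.X_recursion t ht r _ hrs, p.Omega_eq t ht r _ hrs]
    refine riccati_posSemidef (p.submat_cost_posSemidef ht r.1) (p.submat_R_posDef ht r.1)
      (ih _) ?_
    rw [p.K_eq t ht r _ hrs, p.Omega_eq t ht r _ hrs]

theorem Omega_posDef (t : ℕ) (ht : t < p.T) (r : G.InfoNode) : (p.Omega t ht r).PosDef := by
  rw [p.Omega_eq t ht r _ ((G.infoEdge_iff r _).2 rfl)]
  exact posDef_add_transpose_mul_mul (p.submat_R_posDef ht r.1) (p.X_posSemidef _ _ _)

theorem stage_embed (t : ℕ) (r : Finset V) (z x : SubIdx (p.nx t) r → ℝ)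
    (v u : SubIdx (p.nu t) r → ℝ) :
    Sum.elim (embed r z) (embed r v) ⬝ᵥ
        (fromBlocks (p.Q t) (p.S t) (p.S t)ᵀ (p.R t) *ᵥ Sum.elim (embed r x) (embed r u)) =
      Sum.elim z v ⬝ᵥ (fromBlocks (submat (p.Q t) r r) (submat (p.S t) r r)
        (submat (p.S t) r r)ᵀ (submat (p.R t) r r) *ᵥ Sum.elim x u) := by
  simp only [sum_dotProduct_fromBlocks, embed_dotProduct, subvec_mulVec_embed]
  rfl

/-- `riccati_bilin` at the node `r`, for stacked vectors that vanish outside `r`. -/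
theorem node_bilin {t : ℕ} (ht : t < p.T) (r : G.InfoNode) (z x : SubIdx (p.nx t) r.1 → ℝ)
    (u : SubIdx (p.nu t) r.1 → ℝ) :
    Sum.elim (embed r.1 z) (embed r.1 (p.gain t r *ᵥ z)) ⬝ᵥ
        (fromBlocks (p.Q t) (p.S t) (p.S t)ᵀ (p.R t) *ᵥ Sum.elim (embed r.1 x) (embed r.1 u))
      + ((submat (p.A t) (G.next r).1 r.1 + submat (p.B t) (G.next r).1 r.1 * p.gain t r) *ᵥ z) ⬝ᵥ
        (p.X (t + 1) ht (G.next r) *ᵥ subvec (p.A t *ᵥ embed r.1 x + p.B t *ᵥ embed r.1 u)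
          (G.next r).1) = z ⬝ᵥ (p.X t ht.le r *ᵥ x) := by
  have hrs : G.InfoEdge r (G.next r) := (G.infoEdge_iff r _).2 rfl
  have hsub : subvec (p.A t *ᵥ embed r.1 x + p.B t *ᵥ embed r.1 u) (G.next r).1 =
      submat (p.A t) (G.next r).1 r.1 *ᵥ x + submat (p.B t) (G.next r).1 r.1 *ᵥ u := by
    rw [← subvec_mulVec_embed, ← subvec_mulVec_embed]
    rfl
  rw [p.gain_eq ht, stage_embed, hsub, p.X_recursion t ht r _ hrs, p.Omega_eq t ht r _ hrs]
  refine riccati_bilin (p.submat_R_posDef ht r.1) (p.X_posSemidef _ _ _) ?_ z x u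
  rw [p.K_eq t ht r _ hrs, p.Omega_eq t ht r _ hrs]

/-! ### The bilinear form of the cost -/

/-- The bilinear form that belongs to `pathCost`. -/
def pathBilin (x : ∀ t, BlockIdx (p.nx t) → ℝ) (u : ∀ t, BlockIdx (p.nu t) → ℝ)
    (x' : ∀ t, BlockIdx (p.nx t) → ℝ) (u' : ∀ t, BlockIdx (p.nu t) → ℝ) : ℝ :=
  ∑ t ∈ Finset.range p.T,
      Sum.elim (x t) (u t) ⬝ᵥ
        (fromBlocks (p.Q t) (p.S t) (p.S t)ᵀ (p.R t) *ᵥ Sum.elim (x' t) (u' t))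
    + x p.T ⬝ᵥ (p.Qf *ᵥ x' p.T)

theorem pathBilin_self (x : ∀ t, BlockIdx (p.nx t) → ℝ) (u : ∀ t, BlockIdx (p.nu t) → ℝ) :
    p.pathBilin x u x u = p.pathCost x u := rfl

theorem stage_nonneg {t : ℕ} (ht : t < p.T) (x : BlockIdx (p.nx t) → ℝ)
    (u : BlockIdx (p.nu t) → ℝ) :
    0 ≤ Sum.elim x u ⬝ᵥ (fromBlocks (p.Q t) (p.S t) (p.S t)ᵀ (p.R t) *ᵥ Sum.elim x u) :=
  PosSemidef.dotProduct_mulVec_self_nonneg (p.cost_posSemidef t ht) _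

theorem stage_le_pathCost {t : ℕ} (ht : t < p.T) (x : ∀ t, BlockIdx (p.nx t) → ℝ)
    (u : ∀ t, BlockIdx (p.nu t) → ℝ) :
    Sum.elim (x t) (u t) ⬝ᵥ
      (fromBlocks (p.Q t) (p.S t) (p.S t)ᵀ (p.R t) *ᵥ Sum.elim (x t) (u t)) ≤ p.pathCost x u := by
  refine le_add_of_le_of_nonneg ?_ (PosSemidef.dotProduct_mulVec_self_nonneg p.Qf_posSemidef _)
  exact Finset.single_le_sum
    (f := fun t => Sum.elim (x t) (u t) ⬝ᵥ
      (fromBlocks (p.Q t) (p.S t) (p.S t)ᵀ (p.R t) *ᵥ Sum.elim (x t) (u t)))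
    (fun k hk => p.stage_nonneg (Finset.mem_range.1 hk) (x k) (u k)) (Finset.mem_range.2 ht)

theorem pathCost_nonneg (x : ∀ t, BlockIdx (p.nx t) → ℝ) (u : ∀ t, BlockIdx (p.nu t) → ℝ) :
    0 ≤ p.pathCost x u :=
  add_nonneg (Finset.sum_nonneg fun t ht => p.stage_nonneg (Finset.mem_range.1 ht) (x t) (u t))
    (PosSemidef.dotProduct_mulVec_self_nonneg p.Qf_posSemidef _)

theorem dotProduct_mulVec_sub_self {n : Type*} [Fintype n] {M : Matrix n n ℝ} (hM : M.IsHermitian)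
    (a b : n → ℝ) :
    (a - b) ⬝ᵥ (M *ᵥ (a - b)) = a ⬝ᵥ (M *ᵥ a) - 2 * (b ⬝ᵥ (M *ᵥ a)) + b ⬝ᵥ (M *ᵥ b) := by
  have hMt : Mᵀ = M := by simpa using hM.eq
  have h : a ⬝ᵥ (M *ᵥ b) = b ⬝ᵥ (M *ᵥ a) := by
    rw [dotProduct_comm, mulVec_dotProduct_eq, hMt]
  rw [mulVec_sub, sub_dotProduct, dotProduct_sub, dotProduct_sub, h]
  ring

theorem pathCost_sub (x : ∀ t, BlockIdx (p.nx t) → ℝ) (u : ∀ t, BlockIdx (p.nu t) → ℝ)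
    (x' : ∀ t, BlockIdx (p.nx t) → ℝ) (u' : ∀ t, BlockIdx (p.nu t) → ℝ) :
    p.pathCost (x - x') (u - u') =
      p.pathCost x u - 2 * p.pathBilin x' u' x u + p.pathCost x' u' := by
  simp only [pathCost, pathBilin, Pi.sub_apply]
  rw [dotProduct_mulVec_sub_self p.Qf_posSemidef.isHermitian]
  have h : ∀ t ∈ Finset.range p.T,
      Sum.elim (x t - x' t) (u t - u' t) ⬝ᵥ
        (fromBlocks (p.Q t) (p.S t) (p.S t)ᵀ (p.R t) *ᵥ Sum.elim (x t - x' t) (u t - u' t)) =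
      Sum.elim (x t) (u t) ⬝ᵥ
        (fromBlocks (p.Q t) (p.S t) (p.S t)ᵀ (p.R t) *ᵥ Sum.elim (x t) (u t))
      - 2 * (Sum.elim (x' t) (u' t) ⬝ᵥ
        (fromBlocks (p.Q t) (p.S t) (p.S t)ᵀ (p.R t) *ᵥ Sum.elim (x t) (u t)))
      + Sum.elim (x' t) (u' t) ⬝ᵥ
        (fromBlocks (p.Q t) (p.S t) (p.S t)ᵀ (p.R t) *ᵥ Sum.elim (x' t) (u' t)) := by
    intro t ht
    rw [← dotProduct_mulVec_sub_self (p.cost_posSemidef t (Finset.mem_range.1 ht)).isHermitian]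
    congr 2 <;> ext (a | a) <;> rfl
  rw [Finset.sum_congr rfl h, Finset.sum_add_distrib, Finset.sum_sub_distrib, ← Finset.mul_sum]
  ring

/-- Two trajectories driven by the same disturbances, the difference of which costs nothing, have
the same inputs. -/
theorem input_eq_of_pathCost_sub_eq_zero {x x' : ∀ t, BlockIdx (p.nx t) → ℝ}
    {u u' : ∀ t, BlockIdx (p.nu t) → ℝ} {w : ∀ t, BlockIdx (p.nx (t + 1)) → ℝ}
    (h0 : x 0 = x' 0) (hx : ∀ t, x (t + 1) = p.A t *ᵥ x t + p.B t *ᵥ u t + w t)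
    (hx' : ∀ t, x' (t + 1) = p.A t *ᵥ x' t + p.B t *ᵥ u' t + w t)
    (h : p.pathCost (x - x') (u - u') = 0) {t : ℕ} (ht : t < p.T) : u t = u' t := by
  have key : ∀ t < p.T, x t = x' t → u t = u' t := by
    intro t ht hxt
    have h1 := p.stage_le_pathCost ht (x - x') (u - u')
    have h2 : (x - x') t = 0 := by simp [hxt]
    rw [h, h2, sum_dotProduct_fromBlocks] at h1
    simp only [mulVec_zero, zero_dotProduct, dotProduct_zero, zero_add] at h1
    by_contra hne
    have h3 := (p.R_posDef t ht).dotProduct_mulVec_pos (x := (u - u') t)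
      (by simpa [sub_eq_zero] using hne)
    rw [star_trivial] at h3
    linarith
  have hstate : ∀ t ≤ p.T, x t = x' t := by
    intro t
    induction t with
    | zero => exact fun _ => h0
    | succ t ih =>
      intro ht
      rw [hx, hx', ih (by omega), key t (by omega) (ih (by omega))]
  exact key t ht (hstate t ht.le)

end LQProblem

/-! ### Square-integrable random vectors -/

section SquareIntegrable

variable {Ω : Type*} [MeasurableSpace Ω] {P : Measure Ω} {ι κ : Type*}

/-- The components of the random vector `Z` are square-integrable. -/
def SqIntegrable (P : Measure Ω) (Z : Ω → ι → ℝ) : Prop := ∀ a, MemLp (fun ω => Z ω a) 2 P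

namespace SqIntegrable

theorem add {Z Z' : Ω → ι → ℝ} (h : SqIntegrable P Z) (h' : SqIntegrable P Z') :
    SqIntegrable P fun ω => Z ω + Z' ω := fun a => (h a).add (h' a)

theorem sub {Z Z' : Ω → ι → ℝ} (h : SqIntegrable P Z) (h' : SqIntegrable P Z') :
    SqIntegrable P fun ω => Z ω - Z' ω := fun a => (h a).sub (h' a)

theorem sum {γ : Type*} (s : Finset γ) {Z : γ → Ω → ι → ℝ} (h : ∀ c ∈ s, SqIntegrable P (Z c)) :
    SqIntegrable P fun ω => ∑ c ∈ s, Z c ω := fun a => by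
  simp only [Finset.sum_apply]
  exact memLp_finsetSum s fun c hc => h c hc a

theorem mulVec [Fintype κ] {Z : Ω → κ → ℝ} (h : SqIntegrable P Z) (M : Matrix ι κ ℝ) :
    SqIntegrable P fun ω => M *ᵥ Z ω := fun a => by
  simp only [Matrix.mulVec, dotProduct]
  exact memLp_finsetSum _ fun b _ => (h b).const_mul (M a b)

theorem sumElim {Z : Ω → ι → ℝ} {Z' : Ω → κ → ℝ} (h : SqIntegrable P Z) (h' : SqIntegrable P Z') :
    SqIntegrable P fun ω => Sum.elim (Z ω) (Z' ω) := by
  rintro (a | a)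
  · exact h a
  · exact h' a

theorem subvec {V : Type*} {n : V → ℕ} {Z : Ω → BlockIdx n → ℝ} (h : SqIntegrable P Z)
    (s : Finset V) : SqIntegrable P fun ω => subvec (Z ω) s := fun a => h a.1

theorem embed {V : Type*} [DecidableEq V] {n : V → ℕ} {s : Finset V} {Z : Ω → SubIdx n s → ℝ}
    (h : SqIntegrable P Z) : SqIntegrable P fun ω => embed s (Z ω) := fun a => by
  by_cases ha : a.1 ∈ s
  · simp only [embed_of_mem _ ha]
    exact h ⟨a, ha⟩
  · simp only [embed_of_notMem _ ha]
    exact MemLp.zero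

variable [Fintype ι] [Fintype κ]

theorem integrable_bilin {Z : Ω → ι → ℝ} {F : Ω → κ → ℝ} (h : SqIntegrable P Z)
    (h' : SqIntegrable P F) (M : Matrix ι κ ℝ) :
    Integrable (fun ω => Z ω ⬝ᵥ (M *ᵥ F ω)) P := by
  simp only [dotProduct]
  exact integrable_finsetSum _ fun a _ => (h a).integrable_mul (h'.mulVec M a)

theorem integral_bilin {Z : Ω → ι → ℝ} {F : Ω → κ → ℝ} (h : SqIntegrable P Z)
    (h' : SqIntegrable P F) (M : Matrix ι κ ℝ) :
    ∫ ω, Z ω ⬝ᵥ (M *ᵥ F ω) ∂P = ∑ a, ∑ b, M a b * ∫ ω, Z ω a * F ω b ∂P := by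
  have hi : ∀ a b, Integrable (fun ω => M a b * (Z ω a * F ω b)) P := fun a b =>
    ((h a).integrable_mul (h' b)).const_mul _
  calc ∫ ω, Z ω ⬝ᵥ (M *ᵥ F ω) ∂P = ∫ ω, ∑ a, ∑ b, M a b * (Z ω a * F ω b) ∂P := by
        refine integral_congr_ae (.of_forall fun ω => ?_)
        simp only [dotProduct, Matrix.mulVec, Finset.mul_sum]
        exact Finset.sum_congr rfl fun a _ => Finset.sum_congr rfl fun b _ => by ring
    _ = _ := by
        rw [integral_finsetSum _ fun a _ => integrable_finsetSum _ fun b _ => hi a b]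
        refine Finset.sum_congr rfl fun a _ => ?_
        rw [integral_finsetSum _ fun b _ => hi a b]
        exact Finset.sum_congr rfl fun b _ => integral_const_mul _ _

theorem integral_bilin_eq_zero {Z : Ω → ι → ℝ} {F : Ω → κ → ℝ} (h : SqIntegrable P Z)
    (hF : SqIntegrable P F) (M : Matrix ι κ ℝ) (H : ∀ a b, ∫ ω, Z ω a * F ω b ∂P = 0) :
    ∫ ω, Z ω ⬝ᵥ (M *ᵥ F ω) ∂P = 0 := by
  simp only [h.integral_bilin hF, H, mul_zero, Finset.sum_const_zero]

theorem integral_bilin_add_left {Z Z' : Ω → ι → ℝ} {F : Ω → κ → ℝ} (h : SqIntegrable P Z)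
    (h' : SqIntegrable P Z') (hF : SqIntegrable P F) (M : Matrix ι κ ℝ) :
    ∫ ω, (Z ω + Z' ω) ⬝ᵥ (M *ᵥ F ω) ∂P =
      ∫ ω, Z ω ⬝ᵥ (M *ᵥ F ω) ∂P + ∫ ω, Z' ω ⬝ᵥ (M *ᵥ F ω) ∂P := by
  simp only [add_dotProduct]
  exact integral_add (h.integrable_bilin hF M) (h'.integrable_bilin hF M)

theorem integral_bilin_add_right {Z : Ω → ι → ℝ} {F F' : Ω → κ → ℝ} (h : SqIntegrable P Z)
    (hF : SqIntegrable P F) (hF' : SqIntegrable P F') (M : Matrix ι κ ℝ) :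
    ∫ ω, Z ω ⬝ᵥ (M *ᵥ (F ω + F' ω)) ∂P =
      ∫ ω, Z ω ⬝ᵥ (M *ᵥ F ω) ∂P + ∫ ω, Z ω ⬝ᵥ (M *ᵥ F' ω) ∂P := by
  simp only [mulVec_add, dotProduct_add]
  exact integral_add (h.integrable_bilin hF M) (h.integrable_bilin hF' M)

theorem integral_bilin_sum_left {γ : Type*} (s : Finset γ) {Z : γ → Ω → ι → ℝ} {F : Ω → κ → ℝ}
    (h : ∀ c ∈ s, SqIntegrable P (Z c)) (hF : SqIntegrable P F) (M : Matrix ι κ ℝ) :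
    ∫ ω, (∑ c ∈ s, Z c ω) ⬝ᵥ (M *ᵥ F ω) ∂P = ∑ c ∈ s, ∫ ω, Z c ω ⬝ᵥ (M *ᵥ F ω) ∂P := by
  simp only [sum_dotProduct]
  exact integral_finsetSum s fun c hc => (h c hc).integrable_bilin hF M

end SqIntegrable

/-- A Gaussian random vector with mean zero: moments up to order two. -/
theorem moments_of_hasLaw_multivariateGaussian [IsProbabilityMeasure P] [Fintype ι] [DecidableEq ι]
    {Z : Ω → ι → ℝ} {C : Matrix ι ι ℝ} (hC : C.PosSemidef)
    (h : HasLaw (fun ω => WithLp.toLp 2 (Z ω)) (multivariateGaussian 0 C) P) :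
    SqIntegrable P Z ∧ (∀ a, ∫ ω, Z ω a ∂P = 0) ∧
      ∀ a b, ∫ ω, Z ω a * Z ω b ∂P = C a b := by
  have hm : ∀ a : ι, Measurable fun x : EuclideanSpace ℝ ι => x a := fun a => by fun_prop
  have hL : ∀ a : ι, MemLp (fun x : EuclideanSpace ℝ ι => x a) 2 (multivariateGaussian 0 C) :=
    fun a => (EuclideanSpace.proj (𝕜 := ℝ) a).comp_memLp'
      (IsGaussian.memLp_id (multivariateGaussian (0 : EuclideanSpace ℝ ι) C) 2 (by simp))
  have h2 : SqIntegrable P Z := fun a => by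
    have h' := hL a
    rw [← h.map_eq] at h'
    exact h'.comp_of_map h.aemeasurable
  have h1 : ∀ a, ∫ ω, Z ω a ∂P = 0 := fun a => by
    have e1 := h.integral_comp (f := fun x : EuclideanSpace ℝ ι => x a)
      (hm a).aestronglyMeasurable
    have e2 := (EuclideanSpace.proj (𝕜 := ℝ) a).integral_comp_comm (φ := fun x => x)
      (memLp_one_iff_integrable.1
        (IsGaussian.memLp_id (multivariateGaussian (0 : EuclideanSpace ℝ ι) C) 1 (by simp)))
    rw [integral_id_multivariateGaussian, map_zero] at e2
    exact e1.trans e2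
  refine ⟨h2, h1, fun a b => ?_⟩
  have e1 := h.covariance_fun_comp (hm a).aemeasurable (hm b).aemeasurable
  rw [covariance_eval_multivariateGaussian hC] at e1
  rw [← e1, covariance_eq_sub (h2 a) (h2 b)]
  simp [h1]

end SquareIntegrable

/-! ### Information carried by the primitive random vectors -/

namespace LQProblem

variable {V : Type*} [Fintype V] [DecidableEq V] {G : NetworkGraph V} (p : LQProblem G)
variable {Ω : Type*} {x0 : Ω → BlockIdx (p.nx 0) → ℝ} {w : ∀ t, Ω → BlockIdx (p.nx (t + 1)) → ℝ}

/-- The covariance of the primitive random vector `i` of time `t`. -/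
def primitiveCov : ∀ (t : ℕ) (i : V), Matrix (Fin (p.nx t i)) (Fin (p.nx t i)) ℝ
  | 0, i => p.Sigma0 i
  | t + 1, i => p.W t i

theorem primitiveCov_posSemidef {t : ℕ} (ht : t ≤ p.T) (i : V) :
    (p.primitiveCov t i).PosSemidef := by
  cases t with
  | zero => exact p.Sigma0_posSemidef i
  | succ t => exact p.W_posSemidef t ht i

variable (x0 w) in
/-- The σ-algebra generated by the primitive random vectors with index `(k, j) ∈ S`, `k ≤ T`. -/
@[reducible]
def primitiveSigma (S : Set (ℕ × V)) : MeasurableSpace Ω :=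
  ⨆ q ∈ {q : Fin (p.T + 1) × V | ((q.1 : ℕ), q.2) ∈ S},
    MeasurableSpace.comap (fun ω => block (p.primitive x0 w q.1 ω) q.2) inferInstance

theorem primitiveSigma_mono {S S' : Set (ℕ × V)} (h : S ⊆ S') :
    p.primitiveSigma x0 w S ≤ p.primitiveSigma x0 w S' :=
  biSup_mono fun _ hq => h hq

theorem measurable_primitive_primitiveSigma {S : Set (ℕ × V)} {t : ℕ} (ht : t ≤ p.T)
    (q : BlockIdx (p.nx t)) (hq : (t, q.1) ∈ S) :
    Measurable[p.primitiveSigma x0 w S] fun ω => p.primitive x0 w t ω q := by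
  have h1 : Measurable[p.primitiveSigma x0 w S]
      fun ω => block (p.primitive x0 w t ω) q.1 := by
    refine Measurable.mono (comap_measurable _) ?_ le_rfl
    exact le_iSup₂_of_le (f := fun (q : Fin (p.T + 1) × V) (_ : ((q.1 : ℕ), q.2) ∈ S) =>
      MeasurableSpace.comap (fun ω => block (p.primitive x0 w q.1 ω) q.2) inferInstance)
      (⟨t, Nat.lt_succ_of_le ht⟩, q.1) hq le_rfl
  exact (measurable_pi_apply q.2).comp h1

variable {p}

theorem measurable_input_apply (γ : p.Policy) {t : ℕ} {i : V} {m : MeasurableSpace Ω}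
    (h : ∀ (k : ℕ) (q : BlockIdx (p.nx k)), (k : ℕ∞) + G.D i q.1 ≤ t →
      Measurable[m] fun ω => state γ (x0 ω) (fun k => w k ω) k q) (a : Fin (p.nu t i)) :
    Measurable[m] fun ω => input γ (x0 ω) (fun k => w k ω) t ⟨i, a⟩ := by
  refine (measurable_pi_apply a).comp ((γ.measurable t i).comp ?_)
  refine measurable_pi_lambda _ fun q => measurable_pi_lambda _ fun b => ?_
  exact h q.1.1 ⟨q.1.2, b⟩ q.2

/-- Under any policy, `x_t^i` is a function of the primitive random vectors that have reached `i`
by time `t`. -/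
theorem measurable_state (γ : p.Policy) {t : ℕ} (ht : t ≤ p.T) (q : BlockIdx (p.nx t)) :
    Measurable[p.primitiveSigma x0 w (G.known t q.1)]
      fun ω => state γ (x0 ω) (fun k => w k ω) t q := by
  induction t using Nat.strong_induction_on with
  | _ t ih =>
  have hprim := p.measurable_primitive_primitiveSigma (x0 := x0) (w := w) ht q
    (S := G.known t q.1) (by simp [NetworkGraph.known, G.D_self])
  cases t with
  | zero => simpa only [state, primitive] using hprim
  | succ t =>
    simp only [state_succ, Pi.add_apply]
    have hsub : ∀ j, G.D q.1 j ≤ 1 → G.known t j ⊆ G.known (t + 1) q.1 := fun j hj => by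
      refine G.known_subset ?_
      push_cast
      gcongr
    have hle : ∀ j, G.D q.1 j ≤ 1 → p.primitiveSigma x0 w (G.known t j) ≤
      p.primitiveSigma x0 w (G.known (t + 1) q.1) := fun j hj => p.primitiveSigma_mono (hsub j hj)
    refine Measurable.add (Measurable.add ?_ ?_) hprim
    · refine measurable_mulVec_apply (mY := p.primitiveSigma x0 w (G.known (t + 1) q.1)) _ _
        fun b hb => ?_
      have hD : G.D q.1 b.1 ≤ 1 := by
        by_contra h
        exact hb (p.A_zero t ht q.1 b.1 (not_le.1 h) q.2 b.2)
      exact (ih t (Nat.lt_succ_self t) (by omega) b).mono (hle _ hD) le_rfl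
    · refine measurable_mulVec_apply (mY := p.primitiveSigma x0 w (G.known (t + 1) q.1)) _ _
        fun b hb => ?_
      have hD : G.D q.1 b.1 ≤ 1 := by
        by_contra h
        exact hb (p.B_zero t ht q.1 b.1 (not_le.1 h) q.2 b.2)
      refine measurable_input_apply γ (fun k q' hk => ?_) b.2
      have hkt : k ≤ t := NetworkGraph.InfoSet.le (G := G) (i := b.1) ⟨(k, q'.1), hk⟩
      exact (ih k (by omega) (by omega) q').mono
        ((p.primitiveSigma_mono (G.known_subset hk)).trans (hle _ hD)) le_rfl

theorem measurable_input (γ : p.Policy) {t : ℕ} (ht : t < p.T) (q : BlockIdx (p.nu t)) :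
    Measurable[p.primitiveSigma x0 w (G.known t q.1)]
      fun ω => input γ (x0 ω) (fun k => w k ω) t q := by
  refine measurable_input_apply γ (fun k q' hk => ?_) q.2
  have hkt : k ≤ t := NetworkGraph.InfoSet.le (G := G) (i := q.1) ⟨(k, q'.1), hk⟩
  exact (measurable_state γ (by omega) q').mono (p.primitiveSigma_mono (G.known_subset hk)) le_rfl

variable [MeasurableSpace Ω] {P : Measure Ω}

namespace IsNoise

variable (hn : p.IsNoise P x0 w)
include hn

theorem measurable_primitive {t : ℕ} (ht : t ≤ p.T) : Measurable (p.primitive x0 w t) := by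
  cases t with
  | zero => exact hn.measurable_x0
  | succ t => exact hn.measurable_w t ht

theorem primitiveSigma_le (S : Set (ℕ × V)) : p.primitiveSigma x0 w S ≤ ‹MeasurableSpace Ω› := by
  refine iSup₂_le fun q _ => Measurable.comap_le ?_
  have := hn.measurable_primitive (Nat.le_of_lt_succ q.1.2)
  exact measurable_pi_lambda _ fun a => (measurable_pi_apply _).comp this

theorem indep_primitiveSigma {S S' : Set (ℕ × V)} (h : Disjoint S S') :
    Indep (p.primitiveSigma x0 w S) (p.primitiveSigma x0 w S') P := by
  refine indep_iSup_of_disjoint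
    (m := fun q : Fin (p.T + 1) × V =>
      MeasurableSpace.comap (fun ω => block (p.primitive x0 w q.1 ω) q.2) inferInstance)
    (fun q => Measurable.comap_le ?_)
    ((iIndepFun_iff_iIndep _ _ _).1 hn.indep) ?_
  · have := hn.measurable_primitive (Nat.le_of_lt_succ q.1.2)
    exact measurable_pi_lambda _ fun a => (measurable_pi_apply _).comp this
  · rw [Set.disjoint_left] at h ⊢
    exact fun q hq hq' => h hq hq'

theorem measurable_pathCost (γ : p.Policy) :
    Measurable fun ω => p.pathCost (state γ (x0 ω) fun k => w k ω)
      (input γ (x0 ω) fun k => w k ω) := by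
  have hx : ∀ t ≤ p.T, ∀ q, Measurable fun ω => state γ (x0 ω) (fun k => w k ω) t q :=
    fun t ht q => (measurable_state γ ht q).mono (hn.primitiveSigma_le _) le_rfl
  have hu : ∀ t < p.T, ∀ q, Measurable fun ω => input γ (x0 ω) (fun k => w k ω) t q :=
    fun t ht q => (measurable_input γ ht q).mono (hn.primitiveSigma_le _) le_rfl
  simp only [pathCost]
  refine Measurable.add (Finset.measurable_sum _ fun t ht => ?_) ?_
  · rw [Finset.mem_range] at ht
    have h : ∀ a, Measurable fun ω => Sum.elim (state γ (x0 ω) (fun k => w k ω) t)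
        (input γ (x0 ω) (fun k => w k ω) t) a := by
      rintro (a | a)
      · exact hx t ht.le a
      · exact hu t ht a
    exact Finset.measurable_sum _ fun a _ =>
      (h a).mul (measurable_mulVec_apply _ _ fun b _ => h b)
  · exact Finset.measurable_sum _ fun a _ =>
      (hx _ le_rfl a).mul (measurable_mulVec_apply _ _ fun b _ => hx _ le_rfl b)

variable [IsProbabilityMeasure P]

theorem moments {t : ℕ} (ht : t ≤ p.T) (i : V) :
    SqIntegrable P (fun ω => block (p.primitive x0 w t ω) i) ∧
      (∀ a, ∫ ω, block (p.primitive x0 w t ω) i a ∂P = 0) ∧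
      ∀ a b, ∫ ω, block (p.primitive x0 w t ω) i a * block (p.primitive x0 w t ω) i b ∂P =
        p.primitiveCov t i a b := by
  refine moments_of_hasLaw_multivariateGaussian (p.primitiveCov_posSemidef ht i) ?_
  cases t with
  | zero => exact hn.law_x0 i
  | succ t => exact hn.law_w t ht i

theorem sqIntegrable_primitive {t : ℕ} (ht : t ≤ p.T) : SqIntegrable P (p.primitive x0 w t) :=
  fun q => (hn.moments ht q.1).1 q.2

theorem integral_primitive_mul_eq_zero {t : ℕ} (ht : t ≤ p.T) (q : BlockIdx (p.nx t))
    {S : Set (ℕ × V)} (hq : (t, q.1) ∉ S) {f : Ω → ℝ} (hf : Measurable[p.primitiveSigma x0 w S] f) :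
    ∫ ω, p.primitive x0 w t ω q * f ω ∂P = 0 := by
  have h1 := p.measurable_primitive_primitiveSigma (x0 := x0) (w := w) ht q
    (Set.mem_singleton (t, q.1))
  have hI : IndepFun (fun ω => p.primitive x0 w t ω q) f P := by
    rw [IndepFun_iff_Indep]
    exact indep_of_indep_of_le
      (hn.indep_primitiveSigma (Set.disjoint_singleton_left.2 hq)) h1.comap_le hf.comap_le
  rw [hI.integral_fun_mul_eq_mul_integral
    (h1.mono (hn.primitiveSigma_le _) le_rfl).aestronglyMeasurable
    (hf.mono (hn.primitiveSigma_le _) le_rfl).aestronglyMeasurable]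
  have h0 : ∫ ω, p.primitive x0 w t ω q ∂P = 0 := (hn.moments ht q.1).2.1 q.2
  rw [h0, zero_mul]

theorem sqIntegrable_ctrlState {t : ℕ} (ht : t ≤ p.T) (r : G.InfoNode) :
    SqIntegrable P fun ω => p.ctrlState (x0 ω) (fun k => w k ω) t r := by
  classical
  have hent : ∀ t ≤ p.T, ∀ s : G.InfoNode,
      SqIntegrable P fun ω => entering (p.primitive x0 w t ω) s := fun t ht s q => by
    simp only [entering]
    split_ifs with h
    · exact hn.sqIntegrable_primitive ht q.1
    · exact MemLp.zero
  induction t generalizing r with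
  | zero => exact hent 0 ht r
  | succ t ih =>
    exact (SqIntegrable.sum _ fun r' _ => (ih (by omega) r').mulVec _).add (hent (t + 1) ht r)

/-- `ζ_t^r` is uncorrelated with every function of the primitive random vectors that do not label
the node `r` at time `t`. -/
theorem integral_ctrlState_mul_eq_zero {t : ℕ} (ht : t ≤ p.T) (r : G.InfoNode)
    {S : Set (ℕ × V)} (hS : Disjoint S (G.labels t r)) {f : Ω → ℝ}
    (hf : Measurable[p.primitiveSigma x0 w S] f) (hf2 : MemLp f 2 P) (q : SubIdx (p.nx t) r.1) :
    ∫ ω, p.ctrlState (x0 ω) (fun k => w k ω) t r q * f ω ∂P = 0 := by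
  classical
  have hent : ∀ t ≤ p.T, ∀ s : G.InfoNode, Disjoint S (G.labels t s) →
      ∀ q : SubIdx (p.nx t) s.1, ∫ ω, entering (p.primitive x0 w t ω) s q * f ω ∂P = 0 := by
    intro t ht s hS q
    simp only [entering]
    split_ifs with h
    · refine hn.integral_primitive_mul_eq_zero ht q.1 (fun hq => ?_) hf
      have hl := G.mem_labels_root t q.1.1
      rw [h] at hl
      exact Set.disjoint_left.1 hS hq hl
    · simp
  have hentL : ∀ t ≤ p.T, ∀ (s : G.InfoNode) (q : SubIdx (p.nx t) s.1),
      Integrable (fun ω => entering (p.primitive x0 w t ω) s q * f ω) P := by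
    intro t ht s q
    simp only [entering]
    split_ifs with h
    · exact (hn.sqIntegrable_primitive ht q.1).integrable_mul hf2
    · simp
  induction t generalizing r with
  | zero => exact hent 0 ht r hS q
  | succ t ih =>
    have ht' := Nat.le_of_succ_le ht
    have hi : ∀ (r' : G.InfoNode) (b : SubIdx (p.nx t) r'.1) (c : ℝ), Integrable (fun ω =>
        c * (p.ctrlState (x0 ω) (fun k => w k ω) t r' b * f ω)) P := fun r' b c =>
      ((hn.sqIntegrable_ctrlState ht' r' b).integrable_mul hf2).const_mul c
    have hexp : ∀ ω, p.ctrlState (x0 ω) (fun k => w k ω) (t + 1) r q * f ω =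
        ∑ r' : G.InfoNode with G.next r' = r, ∑ b,
          (submat (p.A t) r.1 r'.1 + submat (p.B t) r.1 r'.1 * p.gain t r') q b *
            (p.ctrlState (x0 ω) (fun k => w k ω) t r' b * f ω)
          + entering (p.primitive x0 w (t + 1) ω) r q * f ω := by
      intro ω
      rw [ctrlState, zetaStep, Pi.add_apply, add_mul, Finset.sum_apply, Finset.sum_mul]
      congr 1
      refine Finset.sum_congr rfl fun r' _ => ?_
      simp only [Matrix.mulVec, dotProduct, Finset.sum_mul, mul_assoc]
    simp only [hexp]
    rw [integral_add (integrable_finsetSum _ fun r' _ => integrable_finsetSum _ fun b _ =>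
      hi r' b _) (hentL _ ht r q), hent _ ht r hS q, add_zero,
      integral_finsetSum _ fun r' _ => integrable_finsetSum _ fun b _ => hi r' b _]
    refine Finset.sum_eq_zero fun r' hr' => ?_
    obtain rfl := (Finset.mem_filter.1 hr').2
    rw [integral_finsetSum _ fun b _ => hi r' b _]
    refine Finset.sum_eq_zero fun b _ => ?_
    rw [integral_const_mul, ih ht' r' (hS.mono_right G.labels_subset_next) b, mul_zero]

end IsNoise

end LQProblem

/-! ### Orthogonality -/

section Orthogonal

variable {Ω : Type*} {m : MeasurableSpace Ω} [MeasurableSpace Ω] {P : Measure Ω} {ι κ : Type*}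

variable (P m) in
/-- The components of `Z` are square-integrable and orthogonal to every square-integrable
`m`-measurable random variable. -/
def OrthogonalTo (Z : Ω → ι → ℝ) : Prop :=
  SqIntegrable P Z ∧
    ∀ (a : ι) (f : Ω → ℝ), Measurable[m] f → MemLp f 2 P → ∫ ω, Z ω a * f ω ∂P = 0

namespace OrthogonalTo

theorem mulVec [Fintype κ] {Z : Ω → κ → ℝ} (h : OrthogonalTo m P Z) (M : Matrix ι κ ℝ) :
    OrthogonalTo m P fun ω => M *ᵥ Z ω := by
  refine ⟨h.1.mulVec M, fun a f hf hf2 => ?_⟩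
  have hi : ∀ b, Integrable (fun ω => M a b * (Z ω b * f ω)) P := fun b =>
    ((h.1 b).integrable_mul hf2).const_mul _
  simp only [Matrix.mulVec, dotProduct, Finset.sum_mul, mul_assoc]
  rw [integral_finsetSum _ fun b _ => hi b]
  refine Finset.sum_eq_zero fun b _ => ?_
  rw [integral_const_mul, h.2 b f hf hf2, mul_zero]

theorem sumElim {Z : Ω → ι → ℝ} {Z' : Ω → κ → ℝ} (h : OrthogonalTo m P Z)
    (h' : OrthogonalTo m P Z') : OrthogonalTo m P fun ω => Sum.elim (Z ω) (Z' ω) := by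
  refine ⟨h.1.sumElim h'.1, ?_⟩
  rintro (a | a) f hf hf2
  · exact h.2 a f hf hf2
  · exact h'.2 a f hf hf2

theorem embed {V : Type*} [DecidableEq V] {n : V → ℕ} {s : Finset V} {Z : Ω → SubIdx n s → ℝ}
    (h : OrthogonalTo m P Z) : OrthogonalTo m P fun ω => embed s (Z ω) := by
  refine ⟨h.1.embed, fun a f hf hf2 => ?_⟩
  by_cases ha : a.1 ∈ s
  · simp only [embed_of_mem _ ha]
    exact h.2 ⟨a, ha⟩ f hf hf2
  · simp [embed_of_notMem _ ha]

theorem integral_bilin_eq_zero [Fintype ι] [Fintype κ] {Z : Ω → ι → ℝ} {F : Ω → κ → ℝ}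
    (h : OrthogonalTo m P Z) (hF : SqIntegrable P F) (hFm : ∀ b, Measurable[m] fun ω => F ω b)
    (M : Matrix ι κ ℝ) : ∫ ω, Z ω ⬝ᵥ (M *ᵥ F ω) ∂P = 0 :=
  h.1.integral_bilin_eq_zero hF M fun a b => h.2 a _ (hFm b) (hF b)

end OrthogonalTo

end Orthogonal

namespace LQProblem

variable {V : Type*} [Fintype V] [DecidableEq V] {G : NetworkGraph V} {p : LQProblem G}
variable {Ω : Type*} {x0 : Ω → BlockIdx (p.nx 0) → ℝ} {w : ∀ t, Ω → BlockIdx (p.nx (t + 1)) → ℝ}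

theorem measurable_sub_embed {n : V → ℕ} {t : ℕ} {r : G.InfoNode} {F : Ω → BlockIdx n → ℝ}
    (hF : ∀ q, Measurable[p.primitiveSigma x0 w (G.known t q.1)] fun ω => F ω q)
    (q : BlockIdx n) : Measurable[p.primitiveSigma x0 w (G.knownOutside t r)]
      fun ω => (F ω - embed r.1 (subvec (F ω) r.1)) q := by
  by_cases hq : q.1 ∈ r.1
  · simp only [Pi.sub_apply, embed_of_mem _ hq, subvec, sub_self]
    exact measurable_const
  · simp only [Pi.sub_apply, embed_of_notMem _ hq, sub_zero]
    exact (hF q).mono (p.primitiveSigma_mono (Set.subset_biUnion_of_mem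
      (u := fun i => G.known t i) (s := {i | i ∉ r.1}) hq)) le_rfl

theorem sum_subIdx_eq_of_block {n : V → ℕ} {s : Finset V} {i : V} (hi : i ∈ s)
    {f : SubIdx n s → ℝ} (hf : ∀ q, q.1.1 ≠ i → f q = 0) :
    ∑ q, f q = ∑ a, f ⟨⟨i, a⟩, hi⟩ := by
  refine (Fintype.sum_of_injective (fun a : Fin (n i) => (⟨⟨i, a⟩, hi⟩ : SubIdx n s)) ?_ _ _
    ?_ fun _ => rfl).symm
  · intro a b h
    simpa using h
  · rintro ⟨⟨j, a⟩, hj⟩ hq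
    refine hf _ ?_
    rintro rfl
    exact hq ⟨a, rfl⟩

variable [MeasurableSpace Ω] {P : Measure Ω} [IsProbabilityMeasure P]

namespace IsNoise

variable (hn : p.IsNoise P x0 w)
include hn

theorem orthogonalTo_ctrlState {t : ℕ} (ht : t ≤ p.T) (r : G.InfoNode) {S : Set (ℕ × V)}
    (hS : Disjoint S (G.labels t r)) :
    OrthogonalTo (p.primitiveSigma x0 w S) P
      fun ω => p.ctrlState (x0 ω) (fun k => w k ω) t r :=
  ⟨hn.sqIntegrable_ctrlState ht r,
    fun q _ hf hf2 => hn.integral_ctrlState_mul_eq_zero ht r hS hf hf2 q⟩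

theorem orthogonalTo_entering {t : ℕ} (ht : t ≤ p.T) (s : G.InfoNode) {S : Set (ℕ × V)}
    (hS : ∀ j, (t, j) ∉ S) :
    OrthogonalTo (p.primitiveSigma x0 w S) P fun ω => entering (p.primitive x0 w t ω) s := by
  refine ⟨fun q => ?_, fun q f hf _ => ?_⟩ <;> simp only [entering] <;> split_ifs with h
  · exact hn.sqIntegrable_primitive ht q.1
  · exact MemLp.zero
  · exact hn.integral_primitive_mul_eq_zero ht q.1 (hS _) hf
  · simp

/-- The primitive random vectors of time `t`, paired with themselves at the nodes they enter,
produce the trace terms of the optimal value. -/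
theorem sum_integral_entering {t : ℕ} (ht : t ≤ p.T)
    (Y : ∀ s : G.InfoNode, Matrix (SubIdx (p.nx t) s.1) (SubIdx (p.nx t) s.1) ℝ) :
    ∑ s, ∫ ω, entering (p.primitive x0 w t ω) s ⬝ᵥ
        (Y s *ᵥ subvec (p.primitive x0 w t ω) s.1) ∂P =
      ∑ i, trace (diagBlock (Y (G.root i)) i (G.mem_root i) * p.primitiveCov t i) := by
  classical
  have hsq := hn.sqIntegrable_primitive ht
  have hcov : ∀ (i : V) (a b : Fin (p.nx t i)),
      ∫ ω, p.primitive x0 w t ω ⟨i, a⟩ * p.primitive x0 w t ω ⟨i, b⟩ ∂P =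
        p.primitiveCov t i a b := fun i => (hn.moments ht i).2.2
  have hne : ∀ q q' : BlockIdx (p.nx t), q'.1 ≠ q.1 →
      ∫ ω, p.primitive x0 w t ω q * p.primitive x0 w t ω q' ∂P = 0 := fun q q' h =>
    hn.integral_primitive_mul_eq_zero ht q (S := {(t, q'.1)}) (by simpa using h.symm)
      (p.measurable_primitive_primitiveSigma ht q' (Set.mem_singleton _))
  have h1 : ∀ s : G.InfoNode, ∫ ω, entering (p.primitive x0 w t ω) s ⬝ᵥ
        (Y s *ᵥ subvec (p.primitive x0 w t ω) s.1) ∂P =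
      ∑ q : SubIdx (p.nx t) s.1, if G.root q.1.1 = s then
        ∑ q', Y s q q' * ∫ ω, p.primitive x0 w t ω q.1 * p.primitive x0 w t ω q'.1 ∂P else 0 := by
    intro s
    rw [SqIntegrable.integral_bilin
      (hn.orthogonalTo_entering ht s (S := ∅) (fun _ => Set.notMem_empty _)).1 (hsq.subvec s.1)]
    refine Finset.sum_congr rfl fun q _ => ?_
    simp only [entering]
    split_ifs with h
    · rfl
    · simp
  simp only [h1]
  rw [← Fintype.sum_sigma (fun x : Σ s : G.InfoNode, SubIdx (p.nx t) s.1 =>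
    if G.root x.2.1.1 = x.1 then ∑ q', Y x.1 x.2 q' *
      ∫ ω, p.primitive x0 w t ω x.2.1 * p.primitive x0 w t ω q'.1 ∂P else 0)]
  rw [← Fintype.sum_of_injective (fun q : BlockIdx (p.nx t) =>
    (⟨G.root q.1, ⟨q, G.mem_root q.1⟩⟩ : Σ s : G.InfoNode, SubIdx (p.nx t) s.1)) ?_
    (fun q => ∑ q', Y (G.root q.1) ⟨q, G.mem_root q.1⟩ q' *
      ∫ ω, p.primitive x0 w t ω q * p.primitive x0 w t ω q'.1 ∂P) _ ?_ ?_]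
  · rw [Fintype.sum_sigma]
    refine Finset.sum_congr rfl fun i _ => ?_
    simp only [trace, diag, Matrix.mul_apply]
    refine Finset.sum_congr rfl fun a _ => ?_
    rw [sum_subIdx_eq_of_block (G.mem_root i) fun q hq => by rw [hne _ _ hq, mul_zero]]
    refine Finset.sum_congr rfl fun b _ => ?_
    rw [← hcov]
    exact congrArg₂ _ rfl (integral_congr_ae (.of_forall fun ω => mul_comm _ _))
  · intro q q' h
    have h2 := congrArg (fun c : Σ s : G.InfoNode, SubIdx (p.nx t) s.1 => c.2.1) h
    exact h2
  · rintro ⟨s, q, hq⟩ h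
    refine if_neg fun hs => h ⟨q, ?_⟩
    change G.root q.1 = s at hs
    subst hs
    rfl
  · intro q
    simp

end IsNoise

end LQProblem

/-! ### Pairing an arbitrary trajectory with the candidate optimum -/

namespace LQProblem

variable {V : Type*} [Fintype V] [DecidableEq V] {G : NetworkGraph V} {p : LQProblem G}
variable {Ω : Type*} [MeasurableSpace Ω] {P : Measure Ω}
variable {x0 : Ω → BlockIdx (p.nx 0) → ℝ} {w : ∀ t, Ω → BlockIdx (p.nx (t + 1)) → ℝ}

theorem integrable_pathBilin {γ γ' : p.Policy}
    (hx : ∀ t ≤ p.T, SqIntegrable P fun ω => state γ (x0 ω) (fun k => w k ω) t)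
    (hu : ∀ t < p.T, SqIntegrable P fun ω => input γ (x0 ω) (fun k => w k ω) t)
    (hx' : ∀ t ≤ p.T, SqIntegrable P fun ω => state γ' (x0 ω) (fun k => w k ω) t)
    (hu' : ∀ t < p.T, SqIntegrable P fun ω => input γ' (x0 ω) (fun k => w k ω) t) :
    Integrable (fun ω => p.pathBilin (state γ (x0 ω) fun k => w k ω)
      (input γ (x0 ω) fun k => w k ω) (state γ' (x0 ω) fun k => w k ω)
      (input γ' (x0 ω) fun k => w k ω)) P := by
  refine (integrable_finsetSum _ fun t ht => ?_).add
    ((hx _ le_rfl).integrable_bilin (hx' _ le_rfl) _)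
  rw [Finset.mem_range] at ht
  exact ((hx t ht.le).sumElim (hu t ht)).integrable_bilin ((hx' t ht.le).sumElim (hu' t ht)) _

namespace IsNoise

variable [IsProbabilityMeasure P] (hn : p.IsNoise P x0 w)
include hn

/-- The Riccati step at the node `r` in expectation: since the blocks outside `r` are uncorrelated
with `ζ_t^r`, they may be dropped, and `node_bilin` applies. -/
theorem integral_node_bilin {t : ℕ} (ht : t < p.T) (r : G.InfoNode)
    {x : Ω → BlockIdx (p.nx t) → ℝ} {u : Ω → BlockIdx (p.nu t) → ℝ}
    (hx : SqIntegrable P x) (hu : SqIntegrable P u)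
    (hxm : ∀ q, Measurable[p.primitiveSigma x0 w (G.known t q.1)] fun ω => x ω q)
    (hum : ∀ q, Measurable[p.primitiveSigma x0 w (G.known t q.1)] fun ω => u ω q) :
    ∫ ω, Sum.elim (embed r.1 (p.ctrlState (x0 ω) (fun k => w k ω) t r))
          (embed r.1 (p.gain t r *ᵥ p.ctrlState (x0 ω) (fun k => w k ω) t r)) ⬝ᵥ
        (fromBlocks (p.Q t) (p.S t) (p.S t)ᵀ (p.R t) *ᵥ Sum.elim (x ω) (u ω)) ∂P
      + ∫ ω, ((submat (p.A t) (G.next r).1 r.1 + submat (p.B t) (G.next r).1 r.1 * p.gain t r) *ᵥ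
          p.ctrlState (x0 ω) (fun k => w k ω) t r) ⬝ᵥ
        (p.X (t + 1) ht (G.next r) *ᵥ subvec (p.A t *ᵥ x ω + p.B t *ᵥ u ω) (G.next r).1) ∂P =
    ∫ ω, p.ctrlState (x0 ω) (fun k => w k ω) t r ⬝ᵥ (p.X t ht.le r *ᵥ subvec (x ω) r.1) ∂P := by
  have hz := hn.orthogonalTo_ctrlState ht.le r (G.disjoint_knownOutside_labels t r)
  have hE := hz.embed.sumElim (hz.mulVec (p.gain t r)).embed
  have hL := hz.mulVec (submat (p.A t) (G.next r).1 r.1 +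
    submat (p.B t) (G.next r).1 r.1 * p.gain t r)
  have hxi : SqIntegrable P fun ω => embed r.1 (subvec (x ω) r.1) := (hx.subvec r.1).embed
  have hui : SqIntegrable P fun ω => embed r.1 (subvec (u ω) r.1) := (hu.subvec r.1).embed
  have hxo := hx.sub hxi
  have huo := hu.sub hui
  have hxom := measurable_sub_embed (r := r) hxm
  have huom := measurable_sub_embed (r := r) hum
  have hAB : ∀ {x : Ω → BlockIdx (p.nx t) → ℝ} {u : Ω → BlockIdx (p.nu t) → ℝ},
      SqIntegrable P x → SqIntegrable P u →
      SqIntegrable P fun ω => subvec (p.A t *ᵥ x ω + p.B t *ᵥ u ω) (G.next r).1 :=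
    fun hx hu => ((hx.mulVec (p.A t)).add (hu.mulVec (p.B t))).subvec (G.next r).1
  have h1 : ∀ ω, Sum.elim (x ω) (u ω) =
      Sum.elim (embed r.1 (subvec (x ω) r.1)) (embed r.1 (subvec (u ω) r.1)) +
      Sum.elim (x ω - embed r.1 (subvec (x ω) r.1)) (u ω - embed r.1 (subvec (u ω) r.1)) := by
    intro ω
    ext (a | a) <;> simp
  have h2 : ∀ ω, subvec (p.A t *ᵥ x ω + p.B t *ᵥ u ω) (G.next r).1 =
      subvec (p.A t *ᵥ embed r.1 (subvec (x ω) r.1) + p.B t *ᵥ embed r.1 (subvec (u ω) r.1))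
        (G.next r).1 +
      subvec (p.A t *ᵥ (x ω - embed r.1 (subvec (x ω) r.1)) +
        p.B t *ᵥ (u ω - embed r.1 (subvec (u ω) r.1))) (G.next r).1 := by
    intro ω
    ext a
    simp only [subvec, mulVec_sub, Pi.add_apply, Pi.sub_apply]
    ring
  have e1 : ∫ ω, Sum.elim (embed r.1 (p.ctrlState (x0 ω) (fun k => w k ω) t r))
          (embed r.1 (p.gain t r *ᵥ p.ctrlState (x0 ω) (fun k => w k ω) t r)) ⬝ᵥ
        (fromBlocks (p.Q t) (p.S t) (p.S t)ᵀ (p.R t) *ᵥ Sum.elim (x ω) (u ω)) ∂P =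
      ∫ ω, Sum.elim (embed r.1 (p.ctrlState (x0 ω) (fun k => w k ω) t r))
          (embed r.1 (p.gain t r *ᵥ p.ctrlState (x0 ω) (fun k => w k ω) t r)) ⬝ᵥ
        (fromBlocks (p.Q t) (p.S t) (p.S t)ᵀ (p.R t) *ᵥ
          Sum.elim (embed r.1 (subvec (x ω) r.1)) (embed r.1 (subvec (u ω) r.1))) ∂P := by
    simp only [h1]
    rw [hE.1.integral_bilin_add_right (hxi.sumElim hui) (hxo.sumElim huo),
      hE.integral_bilin_eq_zero (hxo.sumElim huo), add_zero]
    rintro (b | b)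
    · exact hxom b
    · exact huom b
  have e2 : ∫ ω, ((submat (p.A t) (G.next r).1 r.1 +
          submat (p.B t) (G.next r).1 r.1 * p.gain t r) *ᵥ
          p.ctrlState (x0 ω) (fun k => w k ω) t r) ⬝ᵥ
        (p.X (t + 1) ht (G.next r) *ᵥ subvec (p.A t *ᵥ x ω + p.B t *ᵥ u ω) (G.next r).1) ∂P =
      ∫ ω, ((submat (p.A t) (G.next r).1 r.1 +
          submat (p.B t) (G.next r).1 r.1 * p.gain t r) *ᵥ
          p.ctrlState (x0 ω) (fun k => w k ω) t r) ⬝ᵥ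
        (p.X (t + 1) ht (G.next r) *ᵥ subvec (p.A t *ᵥ embed r.1 (subvec (x ω) r.1) +
          p.B t *ᵥ embed r.1 (subvec (u ω) r.1)) (G.next r).1) ∂P := by
    simp only [h2]
    rw [hL.1.integral_bilin_add_right (hAB hxi hui) (hAB hxo huo),
      hL.integral_bilin_eq_zero (hAB hxo huo), add_zero]
    intro b
    exact (measurable_mulVec_apply (mY := p.primitiveSigma x0 w (G.knownOutside t r)) _ _
      fun c _ => hxom c).add
      (measurable_mulVec_apply (mY := p.primitiveSigma x0 w (G.knownOutside t r)) _ _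
      fun c _ => huom c)
  rw [e1, e2, ← integral_add (hE.1.integrable_bilin (hxi.sumElim hui) _)
    (hL.1.integrable_bilin (hAB hxi hui) _)]
  exact integral_congr_ae (.of_forall fun ω => p.node_bilin ht r _ _ _)

/-- One time step of the expected bilinear cost, summed over the nodes. The left-hand side is the
expected bilinear stage cost plus the pairing `∑_s E ζ_{t+1}^s · X_{t+1}^s x_{t+1}^s`. -/
theorem integral_stage_add {t : ℕ} (ht : t < p.T)
    {x : Ω → BlockIdx (p.nx t) → ℝ} {u : Ω → BlockIdx (p.nu t) → ℝ}
    (hx : SqIntegrable P x) (hu : SqIntegrable P u)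
    (hxm : ∀ q, Measurable[p.primitiveSigma x0 w (G.known t q.1)] fun ω => x ω q)
    (hum : ∀ q, Measurable[p.primitiveSigma x0 w (G.known t q.1)] fun ω => u ω q) :
    ∫ ω, Sum.elim (∑ r : G.InfoNode, embed r.1 (p.ctrlState (x0 ω) (fun k => w k ω) t r))
          (p.control t (p.ctrlState (x0 ω) (fun k => w k ω) t)) ⬝ᵥ
        (fromBlocks (p.Q t) (p.S t) (p.S t)ᵀ (p.R t) *ᵥ Sum.elim (x ω) (u ω)) ∂P
      + ∑ s, ∫ ω, p.ctrlState (x0 ω) (fun k => w k ω) (t + 1) s ⬝ᵥ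
          (p.X (t + 1) ht s *ᵥ subvec (p.A t *ᵥ x ω + p.B t *ᵥ u ω + w t ω) s.1) ∂P =
    ∑ r, ∫ ω, p.ctrlState (x0 ω) (fun k => w k ω) t r ⬝ᵥ (p.X t ht.le r *ᵥ subvec (x ω) r.1) ∂P
      + ∑ i, trace (diagBlock (p.X (t + 1) ht (G.root i)) i (G.mem_root i) * p.W t i) := by
  classical
  have hz := fun r => hn.sqIntegrable_ctrlState ht.le r
  have hw : SqIntegrable P (w t) := hn.sqIntegrable_primitive (t := t + 1) ht
  have hAB : SqIntegrable P fun ω => p.A t *ᵥ x ω + p.B t *ᵥ u ω :=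
    (hx.mulVec (p.A t)).add (hu.mulVec (p.B t))
  -- at time `t` nothing depends on the disturbance `w_t`, which has the time index `t + 1`
  have hpast : ∀ i, p.primitiveSigma x0 w (G.known t i) ≤ p.primitiveSigma x0 w {q | q.1 ≤ t} :=
    fun i => p.primitiveSigma_mono fun q hq => NetworkGraph.le_of_mem_known hq
  have hABm : ∀ q, Measurable[p.primitiveSigma x0 w {q | q.1 ≤ t}]
      fun ω => (p.A t *ᵥ x ω + p.B t *ᵥ u ω) q := fun q =>
    (measurable_mulVec_apply (mY := p.primitiveSigma x0 w {q | q.1 ≤ t}) _ _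
      fun c _ => (hxm c).mono (hpast _) le_rfl).add
      (measurable_mulVec_apply (mY := p.primitiveSigma x0 w {q | q.1 ≤ t}) _ _
      fun c _ => (hum c).mono (hpast _) le_rfl)
  have hent : ∀ s, OrthogonalTo (p.primitiveSigma x0 w {q | q.1 ≤ t}) P
      fun ω => entering (w t ω) s := fun s =>
    hn.orthogonalTo_entering (t := t + 1) ht s fun j => by simp
  have hL : ∀ s r : G.InfoNode, OrthogonalTo (p.primitiveSigma x0 w {q | t < q.1}) P fun ω =>
      (submat (p.A t) s.1 r.1 + submat (p.B t) s.1 r.1 * p.gain t r) *ᵥ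
        p.ctrlState (x0 ω) (fun k => w k ω) t r := fun s r =>
    (hn.orthogonalTo_ctrlState ht.le r
      (Set.disjoint_left.2 fun q hq hq' => absurd hq'.1 (not_le.2 hq))).mulVec _
  have hwm : ∀ q, Measurable[p.primitiveSigma x0 w {q | t < q.1}] fun ω => w t ω q := fun q =>
    p.measurable_primitive_primitiveSigma (t := t + 1) ht q (by simp)
  -- the pairing at time `t + 1`
  have hnode : ∀ s, ∫ ω, p.ctrlState (x0 ω) (fun k => w k ω) (t + 1) s ⬝ᵥ
          (p.X (t + 1) ht s *ᵥ subvec (p.A t *ᵥ x ω + p.B t *ᵥ u ω + w t ω) s.1) ∂P =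
      ∑ r : G.InfoNode with G.next r = s,
        ∫ ω, ((submat (p.A t) s.1 r.1 + submat (p.B t) s.1 r.1 * p.gain t r) *ᵥ
          p.ctrlState (x0 ω) (fun k => w k ω) t r) ⬝ᵥ
        (p.X (t + 1) ht s *ᵥ subvec (p.A t *ᵥ x ω + p.B t *ᵥ u ω) s.1) ∂P
      + ∫ ω, entering (w t ω) s ⬝ᵥ (p.X (t + 1) ht s *ᵥ subvec (w t ω) s.1) ∂P := by
    intro s
    have hsum : SqIntegrable P fun ω => ∑ r : G.InfoNode with G.next r = s,
        (submat (p.A t) s.1 r.1 + submat (p.B t) s.1 r.1 * p.gain t r) *ᵥ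
          p.ctrlState (x0 ω) (fun k => w k ω) t r :=
      SqIntegrable.sum _ fun r _ => (hL s r).1
    change ∫ ω, (_ + entering (w t ω) s) ⬝ᵥ (p.X (t + 1) ht s *ᵥ
      (subvec (p.A t *ᵥ x ω + p.B t *ᵥ u ω) s.1 + subvec (w t ω) s.1)) ∂P = _
    rw [hsum.integral_bilin_add_left (hent s).1 ((hAB.subvec s.1).add (hw.subvec s.1)),
      hsum.integral_bilin_add_right (hAB.subvec s.1) (hw.subvec s.1),
      (hent s).1.integral_bilin_add_right (hAB.subvec s.1) (hw.subvec s.1),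
      (hent s).integral_bilin_eq_zero (hAB.subvec s.1) (fun b => hABm b.1),
      SqIntegrable.integral_bilin_sum_left _ (fun r _ => (hL s r).1) (hAB.subvec s.1),
      SqIntegrable.integral_bilin_sum_left _ (fun r _ => (hL s r).1) (hw.subvec s.1),
      Finset.sum_eq_zero fun r _ => (hL s r).integral_bilin_eq_zero (hw.subvec s.1)
        (fun b => hwm b.1) _, add_zero, zero_add]
  have hstage : ∫ ω, Sum.elim
          (∑ r : G.InfoNode, embed r.1 (p.ctrlState (x0 ω) (fun k => w k ω) t r))
          (p.control t (p.ctrlState (x0 ω) (fun k => w k ω) t)) ⬝ᵥ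
        (fromBlocks (p.Q t) (p.S t) (p.S t)ᵀ (p.R t) *ᵥ Sum.elim (x ω) (u ω)) ∂P =
      ∑ r : G.InfoNode, ∫ ω, Sum.elim (embed r.1 (p.ctrlState (x0 ω) (fun k => w k ω) t r))
          (embed r.1 (p.gain t r *ᵥ p.ctrlState (x0 ω) (fun k => w k ω) t r)) ⬝ᵥ
        (fromBlocks (p.Q t) (p.S t) (p.S t)ᵀ (p.R t) *ᵥ Sum.elim (x ω) (u ω)) ∂P := by
    rw [← SqIntegrable.integral_bilin_sum_left _
      (fun r _ => (hz r).embed.sumElim ((hz r).mulVec (p.gain t r)).embed) (hx.sumElim hu)]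
    refine integral_congr_ae (.of_forall fun ω => ?_)
    dsimp only
    congr 1
    ext (a | a) <;> simp [control, Finset.sum_apply]
  have htrace := hn.sum_integral_entering (t := t + 1) ht (p.X (t + 1) ht)
  simp only [primitive, primitiveCov] at htrace
  rw [hstage, Finset.sum_congr rfl fun s _ => hnode s, Finset.sum_add_distrib, htrace,
    sum_fiber_next (fun s r => ∫ ω, ((submat (p.A t) s.1 r.1 +
      submat (p.B t) s.1 r.1 * p.gain t r) *ᵥ p.ctrlState (x0 ω) (fun k => w k ω) t r) ⬝ᵥ
        (p.X (t + 1) ht s *ᵥ subvec (p.A t *ᵥ x ω + p.B t *ᵥ u ω) s.1) ∂P),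
    ← add_assoc, ← Finset.sum_add_distrib]
  congr 1
  exact Finset.sum_congr rfl fun r _ => hn.integral_node_bilin ht r hx hu hxm hum

theorem integral_terminal {x : Ω → BlockIdx (p.nx p.T) → ℝ} (hx : SqIntegrable P x)
    (hxm : ∀ q, Measurable[p.primitiveSigma x0 w (G.known p.T q.1)] fun ω => x ω q) :
    ∫ ω, (∑ r : G.InfoNode, embed r.1 (p.ctrlState (x0 ω) (fun k => w k ω) p.T r)) ⬝ᵥ
        (p.Qf *ᵥ x ω) ∂P =
      ∑ r, ∫ ω, p.ctrlState (x0 ω) (fun k => w k ω) p.T r ⬝ᵥ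
        (p.X p.T le_rfl r *ᵥ subvec (x ω) r.1) ∂P := by
  rw [SqIntegrable.integral_bilin_sum_left _
    (fun r _ => (hn.sqIntegrable_ctrlState le_rfl r).embed) hx]
  refine Finset.sum_congr rfl fun r _ => ?_
  have hz := hn.orthogonalTo_ctrlState le_rfl r (G.disjoint_knownOutside_labels p.T r)
  have hxi : SqIntegrable P fun ω => embed r.1 (subvec (x ω) r.1) := (hx.subvec r.1).embed
  have h := hz.embed.1.integral_bilin_add_right hxi (hx.sub hxi) p.Qf
  rw [hz.embed.integral_bilin_eq_zero (hx.sub hxi) (measurable_sub_embed hxm), add_zero] at h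
  simp only [add_sub_cancel] at h
  rw [h, X_terminal]
  simp only [embed_dotProduct, subvec_mulVec_embed]

theorem sqIntegrable_state_feedback {t : ℕ} (ht : t ≤ p.T) :
    SqIntegrable P fun ω => state p.feedback (x0 ω) (fun k => w k ω) t := by
  simp only [state_feedback p _ _ ht]
  exact SqIntegrable.sum _ fun r _ => (hn.sqIntegrable_ctrlState ht r).embed

theorem sqIntegrable_input_feedback {t : ℕ} (ht : t < p.T) :
    SqIntegrable P fun ω => input p.feedback (x0 ω) (fun k => w k ω) t := by
  simp only [input_feedback p _ _ ht.le, control]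
  exact SqIntegrable.sum _ fun r _ => ((hn.sqIntegrable_ctrlState ht.le r).mulVec _).embed

/-- The expected bilinear cost of the feedback policy against any policy with square-integrable
trajectories is the optimal value. -/
theorem integral_pathBilin (γ : p.Policy)
    (hx : ∀ t ≤ p.T, SqIntegrable P fun ω => state γ (x0 ω) (fun k => w k ω) t)
    (hu : ∀ t < p.T, SqIntegrable P fun ω => input γ (x0 ω) (fun k => w k ω) t) :
    ∫ ω, p.pathBilin (state p.feedback (x0 ω) fun k => w k ω)
      (input p.feedback (x0 ω) fun k => w k ω) (state γ (x0 ω) fun k => w k ω)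
      (input γ (x0 ω) fun k => w k ω) ∂P = p.optimalValue := by
  -- the pairings `∑_r E ζ_t^r · X_t^r x_t^r`, along which the sum over time telescopes
  let β : ℕ → ℝ := fun t => if ht : t ≤ p.T then
    ∑ r, ∫ ω, p.ctrlState (x0 ω) (fun k => w k ω) t r ⬝ᵥ
      (p.X t ht r *ᵥ subvec (state γ (x0 ω) (fun k => w k ω) t) r.1) ∂P else 0
  let c : ℕ → ℝ := fun t => if ht : t < p.T then
    ∑ i, trace (diagBlock (p.X (t + 1) ht (G.root i)) i (G.mem_root i) * p.W t i) else 0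
  have hxs := fun t (ht : t ≤ p.T) => hn.sqIntegrable_state_feedback ht
  have hus := fun t (ht : t < p.T) => hn.sqIntegrable_input_feedback ht
  have hstage : ∀ t ∈ Finset.range p.T,
      ∫ ω, Sum.elim (state p.feedback (x0 ω) (fun k => w k ω) t)
          (input p.feedback (x0 ω) (fun k => w k ω) t) ⬝ᵥ
        (fromBlocks (p.Q t) (p.S t) (p.S t)ᵀ (p.R t) *ᵥ
          Sum.elim (state γ (x0 ω) (fun k => w k ω) t) (input γ (x0 ω) (fun k => w k ω) t)) ∂P =
      (β t - β (t + 1)) + c t := by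
    intro t ht
    rw [Finset.mem_range] at ht
    have h := hn.integral_stage_add ht (hx t ht.le) (hu t ht) (measurable_state γ ht.le)
      (measurable_input γ ht)
    simp only [← state_succ, ← state_feedback p _ _ ht.le, ← input_feedback p _ _ ht.le] at h
    have h1 : β (t + 1) = _ := dif_pos (Nat.succ_le_of_lt ht)
    have h2 : β t = _ := dif_pos ht.le
    have h3 : c t = _ := dif_pos ht
    rw [h1, h2, h3]
    linarith
  have hterm : ∫ ω, state p.feedback (x0 ω) (fun k => w k ω) p.T ⬝ᵥ
      (p.Qf *ᵥ state γ (x0 ω) (fun k => w k ω) p.T) ∂P = β p.T := by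
    have h1 : β p.T = _ := dif_pos le_rfl
    rw [h1, ← hn.integral_terminal (hx p.T le_rfl) (measurable_state γ le_rfl)]
    simp only [state_feedback p _ _ le_rfl]
  have hβ0 : β 0 =
      ∑ i : V, trace (diagBlock (p.X 0 (Nat.zero_le _) (G.root i)) i (G.mem_root i) *
        p.Sigma0 i) := by
    have h1 : β 0 = _ := dif_pos (Nat.zero_le _)
    have h2 := hn.sum_integral_entering (Nat.zero_le _) (p.X 0 (Nat.zero_le _))
    simp only [primitive, primitiveCov] at h2
    rw [h1, ← h2]
    simp only [state, ctrlState]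
  have hsumc : ∑ t : Fin p.T, ∑ i : V,
      trace (diagBlock (p.X (t + 1) t.2 (G.root i)) i (G.mem_root i) * p.W t i) =
      ∑ t ∈ Finset.range p.T, c t := by
    rw [← Fin.sum_univ_eq_sum_range]
    refine Finset.sum_congr rfl fun t _ => ?_
    have h3 : c t = _ := dif_pos t.2
    exact h3.symm
  simp only [pathBilin]
  rw [integral_add (integrable_finsetSum _ fun t ht => ?_)
      ((hxs _ le_rfl).integrable_bilin (hx _ le_rfl) _), integral_finsetSum _ fun t ht => ?_,
    Finset.sum_congr rfl hstage, Finset.sum_add_distrib, Finset.sum_range_sub', hterm,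
    optimalValue, hsumc, hβ0]
  · ring
  all_goals
    rw [Finset.mem_range] at ht
    exact ((hxs t ht.le).sumElim (hus t ht)).integrable_bilin ((hx t ht.le).sumElim (hu t ht)) _

end IsNoise

end LQProblem

/-! ### Policies of finite cost have square-integrable trajectories -/

section FiniteCost

open scoped MatrixOrder Matrix.Norms.L2Operator in
theorem Matrix.PosSemidef.exists_eq_transpose_mul_self {n : Type*} [Fintype n] {M : Matrix n n ℝ}
    (hM : M.PosSemidef) : ∃ N : Matrix n n ℝ, M = Nᵀ * N := by
  classical
  obtain ⟨N, hN⟩ := CStarAlgebra.nonneg_iff_eq_star_mul_self.mp hM.nonneg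
  exact ⟨N, by rw [hN, star_eq_conjTranspose, conjTranspose_eq_transpose_of_trivial]⟩

variable {Ω : Type*} [MeasurableSpace Ω] {P : Measure Ω} {n : Type*} [Fintype n]

/-- If a positive semidefinite quadratic form `Zᵀ M Z` of a random vector is dominated by an
integrable random variable, then `M Z` is square-integrable. -/
theorem SqIntegrable.mulVec_of_quadratic_le {M : Matrix n n ℝ} (hM : M.PosSemidef)
    {Z : Ω → n → ℝ} (hZ : ∀ a, Measurable fun ω => Z ω a) {g : Ω → ℝ} (hg : Integrable g P)
    (h : ∀ ω, Z ω ⬝ᵥ (M *ᵥ Z ω) ≤ g ω) : SqIntegrable P fun ω => M *ᵥ Z ω := by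
  obtain ⟨N, rfl⟩ := hM.exists_eq_transpose_mul_self
  have hN : SqIntegrable P fun ω => N *ᵥ Z ω := by
    intro a
    have hm : Measurable fun ω => (N *ᵥ Z ω) a :=
      LQProblem.measurable_mulVec_apply N a fun b _ => hZ b
    rw [memLp_two_iff_integrable_sq hm.aestronglyMeasurable]
    refine hg.mono' (hm.pow_const 2).aestronglyMeasurable (.of_forall fun ω => ?_)
    rw [Real.norm_of_nonneg (sq_nonneg _)]
    refine le_trans ?_ (h ω)
    rw [← mulVec_mulVec, ← mulVec_dotProduct_eq, dotProduct, pow_two]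
    exact Finset.single_le_sum (f := fun a => (N *ᵥ Z ω) a * (N *ᵥ Z ω) a)
      (fun b _ => mul_self_nonneg _) (Finset.mem_univ a)
  have := hN.mulVec Nᵀ
  simpa only [mulVec_mulVec] using this

end FiniteCost

namespace LQProblem

variable {V : Type*} [Fintype V] [DecidableEq V] {G : NetworkGraph V} {p : LQProblem G}
variable {Ω : Type*} [MeasurableSpace Ω] {P : Measure Ω}
variable {x0 : Ω → BlockIdx (p.nx 0) → ℝ} {w : ∀ t, Ω → BlockIdx (p.nx (t + 1)) → ℝ}

namespace IsNoise

variable (hn : p.IsNoise P x0 w)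
include hn

theorem integrable_pathCost (γ : p.Policy) (h : expectedCost P x0 w γ ≠ ∞) :
    Integrable (fun ω => p.pathCost (state γ (x0 ω) fun k => w k ω)
      (input γ (x0 ω) fun k => w k ω)) P :=
  (lintegral_ofReal_ne_top_iff_integrable (hn.measurable_pathCost γ).aestronglyMeasurable
    (.of_forall fun _ => p.pathCost_nonneg _ _)).1 h

theorem expectedCost_eq_ofReal_integral {γ : p.Policy} (h : expectedCost P x0 w γ ≠ ∞) :
    expectedCost P x0 w γ = ENNReal.ofReal
      (∫ ω, p.pathCost (state γ (x0 ω) fun k => w k ω) (input γ (x0 ω) fun k => w k ω) ∂P) :=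
  (ofReal_integral_eq_lintegral_ofReal (hn.integrable_pathCost γ h)
    (.of_forall fun _ => p.pathCost_nonneg _ _)).symm

theorem sqIntegrable_input_of_state (γ : p.Policy)
    (hcost : Integrable (fun ω => p.pathCost (state γ (x0 ω) fun k => w k ω)
      (input γ (x0 ω) fun k => w k ω)) P) {t : ℕ} (ht : t < p.T)
    (hx : SqIntegrable P fun ω => state γ (x0 ω) (fun k => w k ω) t) :
    SqIntegrable P fun ω => input γ (x0 ω) (fun k => w k ω) t := by
  have hZ : ∀ a, Measurable fun ω => Sum.elim (state γ (x0 ω) (fun k => w k ω) t)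
      (input γ (x0 ω) (fun k => w k ω) t) a := by
    rintro (a | a)
    · exact (measurable_state γ ht.le a).mono (hn.primitiveSigma_le _) le_rfl
    · exact (measurable_input γ ht a).mono (hn.primitiveSigma_le _) le_rfl
  have hM := SqIntegrable.mulVec_of_quadratic_le (p.cost_posSemidef t ht) hZ hcost
    fun ω => p.stage_le_pathCost ht (state γ (x0 ω) fun k => w k ω) (input γ (x0 ω) fun k => w k ω)
  -- the lower block of `M Z` is `Sᵀ x + R u`
  have hRu : SqIntegrable P fun ω => p.R t *ᵥ input γ (x0 ω) (fun k => w k ω) t := by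
    have h1 : SqIntegrable P fun ω => (p.S t)ᵀ *ᵥ state γ (x0 ω) (fun k => w k ω) t +
        p.R t *ᵥ input γ (x0 ω) (fun k => w k ω) t := fun a => by
      have := hM (Sum.inr a)
      simpa only [fromBlocks_mulVec, Sum.elim_inr, Sum.elim_comp_inl, Sum.elim_comp_inr] using this
    simpa only [add_sub_cancel_left] using h1.sub (hx.mulVec (p.S t)ᵀ)
  have hdet : IsUnit (p.R t).det := (isUnit_iff_isUnit_det _).1 (p.R_posDef t ht).isUnit
  simpa only [mulVec_mulVec, nonsing_inv_mul _ hdet, one_mulVec] using hRu.mulVec (p.R t)⁻¹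

variable [IsProbabilityMeasure P]

theorem sqIntegrable_state (γ : p.Policy)
    (hcost : Integrable (fun ω => p.pathCost (state γ (x0 ω) fun k => w k ω)
      (input γ (x0 ω) fun k => w k ω)) P) {t : ℕ} (ht : t ≤ p.T) :
    SqIntegrable P fun ω => state γ (x0 ω) (fun k => w k ω) t := by
  induction t with
  | zero =>
    simp only [state]
    exact hn.sqIntegrable_primitive (Nat.zero_le _)
  | succ t ih =>
    have hx := ih (by omega)
    simp only [state_succ]
    exact ((hx.mulVec _).add ((hn.sqIntegrable_input_of_state γ hcost ht hx).mulVec _)).add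
      (hn.sqIntegrable_primitive (t := t + 1) ht)

/-- The cost of a policy exceeds the optimal value by the cost of the difference of its trajectory
from that of the feedback policy. -/
theorem integral_pathCost_sub (γ : p.Policy) (h : expectedCost P x0 w γ ≠ ∞) :
    Integrable (fun ω => p.pathCost
      ((state γ (x0 ω) fun k => w k ω) - state p.feedback (x0 ω) fun k => w k ω)
      ((input γ (x0 ω) fun k => w k ω) - input p.feedback (x0 ω) fun k => w k ω)) P ∧
    ∫ ω, p.pathCost
      ((state γ (x0 ω) fun k => w k ω) - state p.feedback (x0 ω) fun k => w k ω)
      ((input γ (x0 ω) fun k => w k ω) - input p.feedback (x0 ω) fun k => w k ω) ∂P =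
    ∫ ω, p.pathCost (state γ (x0 ω) fun k => w k ω) (input γ (x0 ω) fun k => w k ω) ∂P
      - p.optimalValue := by
  have hcost := hn.integrable_pathCost γ h
  have hx := fun t (ht : t ≤ p.T) => hn.sqIntegrable_state γ hcost ht
  have hu := fun t (ht : t < p.T) =>
    hn.sqIntegrable_input_of_state γ hcost ht (hx t ht.le)
  have hx' := fun t (ht : t ≤ p.T) => hn.sqIntegrable_state_feedback ht
  have hu' := fun t (ht : t < p.T) => hn.sqIntegrable_input_feedback ht
  have h1 := (integrable_pathBilin hx' hu' hx hu).const_mul 2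
  have h2 := integrable_pathBilin hx' hu' hx' hu'
  simp only [pathBilin_self] at h2
  have h3 := hn.integral_pathBilin p.feedback hx' hu'
  simp only [pathBilin_self] at h3
  simp only [pathCost_sub]
  refine ⟨(hcost.sub h1).add h2, ?_⟩
  refine (integral_add (hcost.sub h1) h2).trans ?_
  rw [integral_sub' hcost h1, integral_const_mul,
    hn.integral_pathBilin γ hx hu, h3]
  ring

theorem integral_pathCost_feedback :
    ∫ ω, p.pathCost (state p.feedback (x0 ω) fun k => w k ω)
      (input p.feedback (x0 ω) fun k => w k ω) ∂P = p.optimalValue :=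
  hn.integral_pathBilin p.feedback (fun _ ht => hn.sqIntegrable_state_feedback ht)
    fun _ ht => hn.sqIntegrable_input_feedback ht

theorem expectedCost_feedback : expectedCost P x0 w p.feedback = ENNReal.ofReal p.optimalValue := by
  rw [← hn.integral_pathCost_feedback]
  refine (ofReal_integral_eq_lintegral_ofReal ?_ (.of_forall fun _ => p.pathCost_nonneg _ _)).symm
  exact integrable_pathBilin (fun _ ht => hn.sqIntegrable_state_feedback ht)
    (fun _ ht => hn.sqIntegrable_input_feedback ht)
    (fun _ ht => hn.sqIntegrable_state_feedback ht)
    fun _ ht => hn.sqIntegrable_input_feedback ht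

theorem optimalValue_nonneg : 0 ≤ p.optimalValue := by
  rw [← hn.integral_pathCost_feedback]
  exact integral_nonneg fun _ => p.pathCost_nonneg _ _

theorem ofReal_optimalValue_le (γ : p.Policy) :
    ENNReal.ofReal p.optimalValue ≤ expectedCost P x0 w γ := by
  by_cases h : expectedCost P x0 w γ = ∞
  · rw [h]
    exact le_top
  rw [hn.expectedCost_eq_ofReal_integral h]
  refine ENNReal.ofReal_le_ofReal (sub_nonneg.1 ?_)
  rw [← (hn.integral_pathCost_sub γ h).2]
  exact integral_nonneg fun _ => p.pathCost_nonneg _ _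

/-- A policy that attains the optimal value almost surely generates the inputs of the feedback
policy. -/
theorem input_ae_eq_of_expectedCost_le (γ : p.Policy)
    (h : expectedCost P x0 w γ ≤ ENNReal.ofReal p.optimalValue) :
    ∀ᵐ ω ∂P, ∀ t < p.T, input γ (x0 ω) (fun k => w k ω) t =
      input p.feedback (x0 ω) (fun k => w k ω) t := by
  have hfin : expectedCost P x0 w γ ≠ ∞ := ne_top_of_le_ne_top ENNReal.ofReal_ne_top h
  obtain ⟨hint, heq⟩ := hn.integral_pathCost_sub γ hfin
  rw [hn.expectedCost_eq_ofReal_integral hfin,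
    ENNReal.ofReal_le_ofReal_iff hn.optimalValue_nonneg] at h
  have h0 := (integral_eq_zero_iff_of_nonneg (fun _ => p.pathCost_nonneg _ _) hint).1
    (le_antisymm (by rw [heq]; linarith) (integral_nonneg fun _ => p.pathCost_nonneg _ _))
  filter_upwards [h0] with ω hω t ht
  exact p.input_eq_of_pathCost_sub_eq_zero (by simp only [state]) (state_succ γ _ _)
    (state_succ p.feedback _ _) hω ht

end IsNoise

end LQProblem

end

theorem theorem1 {V : Type*} [Fintype V] [DecidableEq V] (G : NetworkGraph V)
    (hG : G.NoDelayFreeCycle) (p : LQProblem G)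
    {Ω : Type*} [MeasurableSpace Ω] (P : Measure Ω) [IsProbabilityMeasure P]
    (x0 : Ω → BlockIdx (p.nx 0) → ℝ) (w : ∀ t, Ω → BlockIdx (p.nx (t + 1)) → ℝ)
    (hnoise : p.IsNoise P x0 w) :
    -- the inverses in the recursion exist
    (∀ (t : ℕ) (ht : t < p.T) (r : G.InfoNode), IsUnit (p.Omega t ht r)) ∧
    -- an admissible policy generates the stated inputs, and it is optimal
    (∃ γ : p.Policy, LQProblem.IsOptimal P x0 w γ ∧
      ∀ (ω : Ω) (t : ℕ) (ht : t < p.T) (i : V),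
        subvec (LQProblem.input γ (x0 ω) (fun k => w k ω) t) {i} =
          p.optimalInput (x0 ω) (fun k => w k ω) t ht i) ∧
    -- uniqueness: every optimal policy generates the stated inputs almost surely
    (∀ γ : p.Policy, LQProblem.IsOptimal P x0 w γ →
      ∀ᵐ ω ∂P, ∀ (t : ℕ) (ht : t < p.T) (i : V),
        subvec (LQProblem.input γ (x0 ω) (fun k => w k ω) t) {i} =
          p.optimalInput (x0 ω) (fun k => w k ω) t ht i) ∧
    -- the optimal expected cost
    0 ≤ p.optimalValue ∧
    IsLeast (Set.range fun γ : p.Policy => LQProblem.expectedCost P x0 w γ)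
      (ENNReal.ofReal p.optimalValue) := by

  have hcost := hnoise.expectedCost_feedback
  have hinput : ∀ (ω : Ω) (t : ℕ) (ht : t < p.T) (i : V),
      subvec (LQProblem.input p.feedback (x0 ω) (fun k => w k ω) t) {i} =
        p.optimalInput (x0 ω) (fun k => w k ω) t ht i := fun ω t ht i => by
    rw [p.optimalInput_eq, p.input_feedback _ _ ht.le]
  refine ⟨fun t ht r => (p.Omega_posDef t ht r).isUnit, ⟨p.feedback, fun γ => ?_, hinput⟩,
    fun γ hγ => ?_, hnoise.optimalValue_nonneg, ⟨p.feedback, hcost⟩, ?_⟩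
  · rw [hcost]
    exact hnoise.ofReal_optimalValue_le γ
  · filter_upwards [hnoise.input_ae_eq_of_expectedCost_le γ ((hγ p.feedback).trans hcost.le)]
      with ω hω t ht i
    rw [hω t ht, hinput]
  · rintro _ ⟨γ, rfl⟩
    exact hnoise.ofReal_optimalValue_le γ
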